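/- **Setting.** A time-slotted wireless multi-hop network has a finite set $\mathcal V$ of devices, a finite set $\mathcal W$ of virtual sinks, commodities (destinations) $\mathcal C=\mathcal V\sqcup\mathcal W$, a strongly connected directed connectivity graph $(\mathcal V,\mathcal E)$, and a conflict graph $(\mathcal E,\mathcal H)$ in which any two distinct links leaving the same device conflict (interface conflict). Each $w\in\mathcal W$ is attached to a (possibly empty) set of devices; a packet of commodity $c$ leaves the network on reaching device $c$ if $c\in\mathcal V$, or any device to which $c$ is attached if $c\in\mathcal W$. Such devices are the destinations of $c$. The real-time link-rate vectors $r(t)\in\mathbb R_{\ge 0}^{\mathcal E}$ are i.i.d. over slots with finite second moments and positive mean on every link. The biases $B_i^{(c)}\ge 0$ are constants. The exogenous arrival vectors $A(t)\in\mathbb R_{\ge 0}^{\mathcal V\times\mathcal C}$ are i.i.d. over slots, with finite second moments, and independent of the link rates; their mean is the arrival-rate vector $\lambda$. From an initial state $Q(0)\ge 0$, the queues satisfy $Q_i^{(c)}(t)=0$ if $i$ is a destination of $c$, and otherwise $$Q_i^{(c)}(t+1)=Q_i^{(c)}(t)-\sum_{(i,j)\in\mathcal E}\mu_{ij}^{(c)}(t)+\sum_{(j,i)\in\mathcal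 E}\mu_{ji}^{(c)}(t)+A_i^{(c)}(t).$$ Let $U_{ij}^{(c)}=(Q_i^{(c)}+B_i^{(c)})-(Q_j^{(c)}+B_j^{(c)})$ be the pressure of commodity $c$ on link $(i,j)$. Both policies below choose, in every slot, initial assignments $\gamma_{ij}^{(c)}$, link utilities $w_{ij}=\sum_c\gamma_{ij}^{(c)}\max\{U_{ij}^{(c)},0\}$, a schedule $x\in\{0,1\}^{\mathcal E}$ that maximizes $\sum_e x_e w_e$ subject to $x_{e}+x_{f}\le 1$ for conflicting links $e,f$, and the final rates $\mu_{ij}^{(c)}=\gamma_{ij}^{(c)}x_{ij}$. They differ only in the initial assignments. * *Classic SP-BP*: on each link a commodity $c^*_{ij}\in\arg\max_{c\in\mathcal C}U_{ij}^{(c)}$ is selected, and $\gamma_{ij}^{(c)}=\min\{r_{ij},Q_i^{(c)}\}$ if $c=c^*_{ij}$ and $U_{ij}^{(c)}>0$, and $\gamma_{ij}^{(c)}=0$ otherwise. * *MaxU SP-BP*: let $\alpha_{ij}^{(c)}=1$ if $U_{ij}^{(c)}>0$ and $Q_i^{(c)}>0$, and $\alpha_{ij}^{(c)}=0$ otherwise.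 Order the commodities as $c_1,c_2,\dots$ by decreasing $\alpha_{ij}^{(c)}U_{ij}^{(c)}$, and set successively $\gamma_{ij}^{(c_n)}=\min\{\alpha_{ij}^{(c_n)}\max\{r_{ij}-\sum_{m<n}\gamma_{ij}^{(c_m)},0\},\,Q_i^{(c_n)}\}$. In both, ties (in the argmax, the sorting and the schedule) are broken by arbitrary measurable rules that may depend on the slot, the current link rates and the current queue state. A policy *stabilizes* $\lambda\in\mathbb R_{\ge 0}^{\mathcal V\times\mathcal C}$ if, for every arrival process as above with mean $\lambda$, $$\limsup_{T\to\infty}\frac1T\sum_{t=0}^{T-1}\mathbb E\big[Q_i^{(c)}(t)\big]<\infty\qquad\text{for all } i\in\mathcal V,\ c\in\mathcal C.$$ Its *network capacity region* is the set of all $\lambda$ that it stabilizes. **Theorem.** With everything else equal (the same connectivity and conflict graphs, sink attachments, law of the link rates, biases and initial queue state, and arbitrary tie-breaking in each policy), MaxU SP-BP does not shrink the network capacity region of classic SP-BP: $\hat\Lambda\subseteq\tilde\Lambda$, where $\hat\Lambda$ and $\tilde\Lambda$ are the network capacity regions of classic SP-BP and of MaxU SP-BP. That is, every exogenous arrival-rate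 vector that classic SP-BP stabilizes is also stabilized by MaxU SP-BP. -/

import Mathlib

open MeasureTheory Filter
open scoped ENNReal

noncomputable section

/-- A time-slotted wireless multi-hop network with devices `V` and virtual sinks `W`.
The commodities (destinations) are the elements of `V ⊕ W`. -/
structure WirelessNetwork (V W : Type*) [Fintype V] [Fintype W] where
  /-- the directed links of the connectivity graph -/
  links : Finset (V × V)
  /-- the connectivity graph is strongly connected -/
  strongly_connected : ∀ i j : V, Relation.ReflTransGen (fun a b => (a, b) ∈ links) i j
  /-- the devices to which a virtual sink is attached (possibly none) -/
  host : W → Set V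
  /-- the conflict graph -/
  conflict : SimpleGraph links
  /-- interface conflicts: a device never transmits on two of its outgoing links at once -/
  interface_conflict : ∀ e f : links, e ≠ f → e.1.1 = f.1.1 → conflict.Adj e f
  /-- the queue-agnostic biases -/
  bias : V → V ⊕ W → ℝ
  bias_nonneg : ∀ i c, 0 ≤ bias i c
  /-- the law of the vector of real-time link rates in one slot -/
  rateLaw : Measure (links → ℝ)
  rate_isProbability : IsProbabilityMeasure rateLaw
  rate_nonneg : ∀ᵐ r ∂rateLaw, ∀ e, 0 ≤ r e
  rate_memLp : ∀ e, MemLp (fun r : links → ℝ => r e) 2 rateLaw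
  /-- the long-term average rate of every link is positive -/
  rate_pos : ∀ e, 0 < ∫ r, r e ∂rateLaw

namespace WirelessNetwork

variable {V W : Type*} [Fintype V] [Fintype W] (N : WirelessNetwork V W)

/-- The directed links, as a type. -/
abbrev Link : Type _ := {e : V × V // e ∈ N.links}

/-- Packets of commodity `c` leave the network on reaching device `i`. -/
def IsDestination (i : V) : V ⊕ W → Prop
  | Sum.inl v => v = i
  | Sum.inr w => i ∈ N.host w

/-- The pressure `U_ij^(c)` of commodity `c` on a link `e = (i, j)` in queue state `Q`, where
the biased backlog is `U_i^(c) = Q_i^(c) + B_i^(c)`. -/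
def pressure (Q : V → V ⊕ W → ℝ) (e : N.Link) (c : V ⊕ W) : ℝ :=
  (Q e.1.1 c + N.bias e.1.1 c) - (Q e.1.2 c + N.bias e.1.2 c)

open Classical in
/-- The MaxU filter: `1` if the pressure and the queue at the transmitter are positive,
`0` otherwise. -/
def eligible (Q : V → V ⊕ W → ℝ) (e : N.Link) (c : V ⊕ W) : ℝ :=
  if 0 < N.pressure Q e c ∧ 0 < Q e.1.1 c then 1 else 0

open Classical in
/-- `γ` is an initial assignment of the rate `r` of the link `e` by exclusive commodity
selection, for some commodity of maximal pressure. -/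
def IsExclusiveAssignment (Q : V → V ⊕ W → ℝ) (e : N.Link) (r : ℝ) (γ : V ⊕ W → ℝ) : Prop :=
  ∃ cOpt : V ⊕ W, (∀ c, N.pressure Q e c ≤ N.pressure Q e cOpt) ∧
    ∀ c, γ c = if c = cOpt ∧ 0 < N.pressure Q e c then min r (Q e.1.1 c) else 0

/-- `γ` is an initial assignment of the rate `r` of the link `e` by maximum-utility
multi-commodity selection: for some ordering `σ` of the commodities by decreasing filtered
pressure, the residual rate is allocated sequentially. -/
def IsMaxUAssignment (Q : V → V ⊕ W → ℝ) (e : N.Link) (r : ℝ) (γ : V ⊕ W → ℝ) : Prop :=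
  ∃ σ : Fin (Fintype.card (V ⊕ W)) ≃ V ⊕ W,
    Antitone (fun n => N.eligible Q e (σ n) * N.pressure Q e (σ n)) ∧
    ∀ n, γ (σ n) =
      min (N.eligible Q e (σ n) * max (r - ∑ m ∈ Finset.Iio n, γ (σ m)) 0) (Q e.1.1 (σ n))

/-- The utility of link `e` under the initial assignment `γ`. -/
def utility (Q : V → V ⊕ W → ℝ) (γ : N.Link → V ⊕ W → ℝ) (e : N.Link) : ℝ :=
  ∑ c, γ e c * max (N.pressure Q e c) 0

/-- A 0/1 schedule that activates no two conflicting links. -/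
def IsSchedule (x : N.Link → ℝ) : Prop :=
  (∀ e, x e = 0 ∨ x e = 1) ∧ ∀ e f, N.conflict.Adj e f → x e + x f ≤ 1

/-- A schedule of maximum total utility (MaxWeight scheduling). -/
def IsMaxWeightSchedule (w x : N.Link → ℝ) : Prop :=
  N.IsSchedule x ∧ ∀ y, N.IsSchedule y → ∑ e, y e * w e ≤ ∑ e, x e * w e

/-- `μ` is a final rate assignment, in queue state `Q` and with real-time link rates `r`, of
biased backpressure with the per-link initial assignments specified by `Select`. -/
def IsFinalAssignment
    (Select : (V → V ⊕ W → ℝ) → N.Link → ℝ → (V ⊕ W → ℝ) → Prop)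
    (Q : V → V ⊕ W → ℝ) (r : N.Link → ℝ) (μ : N.Link → V ⊕ W → ℝ) : Prop :=
  ∃ (γ : N.Link → V ⊕ W → ℝ) (x : N.Link → ℝ),
    (∀ e, Select Q e (r e) (γ e)) ∧
    N.IsMaxWeightSchedule (N.utility Q γ) x ∧
    ∀ e c, μ e c = γ e c * x e

/-- A control policy: the rate assignment of every link-commodity pair as a function of the
slot, the real-time link rates and the queue state. -/
abbrev Policy : Type _ :=
  ℕ → (N.Link → ℝ) → (V → V ⊕ W → ℝ) → N.Link → V ⊕ W → ℝ

/-- A measurable policy that in every slot and state takes a decision of biased backpressure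
with initial assignments specified by `Select`; ties are broken arbitrarily. -/
def IsBackpressure
    (Select : (V → V ⊕ W → ℝ) → N.Link → ℝ → (V ⊕ W → ℝ) → Prop) (π : N.Policy) : Prop :=
  (∀ t, Measurable fun p : (N.Link → ℝ) × (V → V ⊕ W → ℝ) => π t p.1 p.2) ∧
  ∀ t r Q, (∀ e, 0 ≤ r e) → (∀ i c, 0 ≤ Q i c) → (∀ i c, N.IsDestination i c → Q i c = 0) →
    N.IsFinalAssignment Select Q r (π t r Q)

/-- Classic SP-BP (exclusive commodity selection), with some tie-breaking. -/
def IsClassicSPBP (π : N.Policy) : Prop := N.IsBackpressure N.IsExclusiveAssignment π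

/-- MaxU SP-BP (link sharing), with some tie-breaking. -/
def IsMaxUSPBP (π : N.Policy) : Prop := N.IsBackpressure N.IsMaxUAssignment π

open Classical in
/-- The queue lengths under the policy `π`, started from `Q₀`. Here `(ω t).1` collects the
exogenous arrivals in slot `t` and `(ω t).2` the real-time link rates in slot `t`. -/
def queue (π : N.Policy) (Q₀ : V → V ⊕ W → ℝ) (ω : ℕ → (V → V ⊕ W → ℝ) × (N.Link → ℝ)) :
    ℕ → V → V ⊕ W → ℝ
  | 0 => Q₀
  | t + 1 => fun i c =>
      if N.IsDestination i c then 0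
      else queue π Q₀ ω t i c
        - ∑ e : N.Link, (if e.1.1 = i then π t (ω t).2 (queue π Q₀ ω t) e c else 0)
        + ∑ e : N.Link, (if e.1.2 = i then π t (ω t).2 (queue π Q₀ ω t) e c else 0)
        + (ω t).1 i c

/-- The law of the arrivals and link rates when the arrivals are i.i.d. over slots with law `ν`
and independent of the link rates, which are i.i.d. over slots. -/
def processLaw (ν : Measure (V → V ⊕ W → ℝ)) :
    Measure (ℕ → (V → V ⊕ W → ℝ) × (N.Link → ℝ)) :=
  Measure.infinitePi fun _ => ν.prod N.rateLaw

/-- Strong stability: the time averages of all expected queue lengths are bounded. -/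
def IsStronglyStable (π : N.Policy) (Q₀ : V → V ⊕ W → ℝ) (ν : Measure (V → V ⊕ W → ℝ)) : Prop :=
  ∀ i c, limsup (fun T : ℕ =>
    (∑ t ∈ Finset.range T, ∫⁻ ω, ENNReal.ofReal (N.queue π Q₀ ω t i c) ∂N.processLaw ν) / (T : ℝ≥0∞))
      atTop < ∞

/-- The law of the exogenous arrivals of one slot, with arrival-rate vector `lam`: non-negative
arrivals with finite second moments and mean `lam`. -/
structure IsArrivalLaw (lam : V → V ⊕ W → ℝ) (ν : Measure (V → V ⊕ W → ℝ)) : Prop where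
  isProbability : IsProbabilityMeasure ν
  nonneg : ∀ᵐ a ∂ν, ∀ i c, 0 ≤ a i c
  memLp : ∀ i c, MemLp (fun a : V → V ⊕ W → ℝ => a i c) 2 ν
  mean : ∀ i c, ∫ a, a i c ∂ν = lam i c

/-- The network capacity region of the policy `π`: the arrival-rate vectors that it stabilizes,
whatever the law of the arrivals with these rates. -/
def capacityRegion (π : N.Policy) (Q₀ : V → V ⊕ W → ℝ) : Set (V → V ⊕ W → ℝ) :=
  {lam | (∀ i c, 0 ≤ lam i c) ∧ ∀ ν, IsArrivalLaw lam ν → N.IsStronglyStable π Q₀ ν}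

end WirelessNetwork

end

/-! For a nonnegative weight vector `q` on queues, let `maxValue q r` be the largest total weight of
a schedule when link `e` carries rate `r e` times the largest positive part of a difference of `q`
across `e`, and let `meanValue q` be its mean over the link rates. This single function governs both
policies.

Necessity. Let `q` vanish at destinations. However a policy acts, if it respects schedules, rates
and queues, one slot of service lowers the `q`-weighted backlog by at most `maxValue q r`. The
backlog therefore dominates a random walk with step "weighted arrivals minus `maxValue`", of mean `∑
q * lam - meanValue q`. If this mean is nonnegative and the step is not almost surely zero, the
expected positive part of the walk is nondecreasing and unbounded, which contradicts bounded time
averages of the backlog. Degeneracy is excluded by testing against one particular arrival law,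
on-off arrivals (`0` or `2 * lam`, each with probability one half). A stabilized `lam` thus
satisfies the strict inequality `∑ q * lam < meanValue q`, even on the boundary where the drift is
zero (`IsStronglyStable.sum_mul_lt_meanValue`).

Sufficiency. Both sides are positively homogeneous and continuous in `q`, so compactness of a
simplex turns the strict inequalities into a uniform slack `ε`
(`exists_pos_forall_add_le_meanValue`). MaxU with MaxWeight scheduling achieves `maxValue Q r` at
the current queue state `Q`, up to an error free of `Q` (`IsFinalAssignment.maxValue_le`): a
commodity of large pressure also has a queue longer than the link rate, so the sorted allocation
spends the whole rate on pressures at least as large. The quadratic Lyapunov function then has drift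
at most a constant minus `2 * ε` times each queue, and telescoping gives stability for every arrival
law of mean `lam`.

Commodities without any destination need separate care: stability forces their arrival rates to
vanish, after which their total backlog is conserved. Of classic SP-BP only feasibility is used. -/

section RandomWalk

/-! ### Random walks with nonnegative drift -/

open ProbabilityTheory

variable {Ω : Type*} [MeasurableSpace Ω] {P : Measure Ω} [IsProbabilityMeasure P] {X : ℕ → Ω → ℝ}

/-- The partial sums of an i.i.d. sequence with nonnegative mean form a submartingale. -/
theorem submartingale_sum_range_succ (hmeas : ∀ n, Measurable (X n)) (hindep : iIndepFun X P)
    (hint : ∀ n, Integrable (X n) P) (hmean : ∀ n, 0 ≤ ∫ ω, X n ω ∂P) :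
    Submartingale (fun n ω => ∑ s ∈ Finset.range (n + 1), X s ω)
      (Filtration.natural X fun n => (hmeas n).stronglyMeasurable) P := by
  set 𝒢 := Filtration.natural X fun n => (hmeas n).stronglyMeasurable with h𝒢
  have hX : ∀ s n, s ≤ n → StronglyMeasurable[𝒢 n] (X s) := fun s n h =>
    ((Filtration.stronglyAdapted_natural fun n => (hmeas n).stronglyMeasurable) s).mono (𝒢.mono h)
  refine submartingale_of_condExp_sub_nonneg_nat (fun n => ?_) (fun n => ?_) fun n => ?_
  · refine Finset.stronglyMeasurable_fun_sum _ fun s hs => hX s n ?_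
    have := Finset.mem_range.1 hs
    omega
  · exact integrable_finsetSum _ fun s _ => hint s
  · have hsub : ((fun ω => ∑ s ∈ Finset.range (n + 1 + 1), X s ω) -
        fun ω => ∑ s ∈ Finset.range (n + 1), X s ω) = X (n + 1) := by
      funext ω
      simp [Finset.sum_range_succ]
    have hcond := condExp_indep_eq (μ := P) (hmeas (n + 1)).comap_le (𝒢.le n)
      (comap_measurable (X (n + 1))).stronglyMeasurable
      (iIndepFun.indep_comap_natural_of_lt (fun n => (hmeas n).stronglyMeasurable) hindep
        (Nat.lt_succ_self n))
    rw [hsub]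
    filter_upwards [hcond] with ω hω
    rw [hω]
    exact hmean _

/-- The expected positive part of a nondegenerate random walk with nonnegative drift is
unbounded. -/
theorem exists_lt_integral_posPart_sum (hmeas : ∀ n, Measurable (X n)) (hindep : iIndepFun X P)
    (hident : ∀ n, P.map (X n) = P.map (X 0)) (hint : ∀ n, Integrable (X n) P)
    (hmean : ∀ n, 0 ≤ ∫ ω, X n ω ∂P) (hne : ¬ X 0 =ᵐ[P] 0) (K : ℝ) :
    ∃ n, K < ∫ ω, max (∑ s ∈ Finset.range (n + 1), X s ω) 0 ∂P := by
  by_contra! hK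
  have hsub := submartingale_sum_range_succ hmeas hindep hint hmean
  set S : ℕ → Ω → ℝ := fun n ω => ∑ s ∈ Finset.range (n + 1), X s ω with hS
  have hSint : ∀ n, Integrable (S n) P := hsub.integrable
  have hmS : ∀ n, 0 ≤ ∫ ω, S n ω ∂P := fun n => by
    simp only [hS]
    rw [integral_finsetSum _ fun s _ => hint s]
    exact Finset.sum_nonneg fun s _ => hmean s
  have hbdd : ∀ n, eLpNorm (S n) 1 P ≤ ((2 * K).toNNReal : ℝ≥0∞) := by
    intro n
    rw [eLpNorm_one_eq_lintegral_enorm, ← ofReal_integral_norm_eq_lintegral_enorm (hSint n)]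
    refine ENNReal.ofReal_le_ofReal ?_
    -- Since `|s| = 2 * max s 0 - s` and the mean of `S n` is nonnegative, a bound on the positive
    -- parts bounds the walk in `L¹`.
    have h1 : ∫ ω, ‖S n ω‖ ∂P = 2 * ∫ ω, max (S n ω) 0 ∂P - ∫ ω, S n ω ∂P := by
      rw [← integral_const_mul, ← integral_sub ((hSint n).pos_part.const_mul 2) (hSint n)]
      refine integral_congr_ae (Eventually.of_forall fun ω => ?_)
      simp only [Real.norm_eq_abs]
      rcases le_total 0 (S n ω) with h | h
      · rw [abs_of_nonneg h, max_eq_left h]; ring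
      · rw [abs_of_nonpos h, max_eq_right h]; ring
    have h2 := hK n
    have h3 := hmS n
    simp only [hS] at h1 h2 h3 ⊢
    linarith
  -- An `L¹`-bounded submartingale converges almost surely, so its increments tend to zero. They all
  -- have the same law, so that law must be the point mass at zero.
  have hconv := hsub.ae_tendsto_limitProcess hbdd
  have hX0 : ∀ᵐ ω ∂P, Tendsto (fun n => X (n + 1) ω) atTop (nhds ((0 : Ω → ℝ) ω)) := by
    filter_upwards [hconv] with ω hω
    have h := (hω.comp (tendsto_add_atTop_nat 1)).sub hω
    simp only [sub_self] at h
    refine h.congr fun n => ?_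
    simp [hS, Finset.sum_range_succ]
  have hmeasure := tendstoInMeasure_of_tendsto_ae
    (fun n => (hmeas (n + 1)).aestronglyMeasurable) hX0
  apply hne
  have hzero : ∀ ε : ℝ≥0∞, 0 < ε → P {ω | ε ≤ edist (X 0 ω) 0} = 0 := by
    intro ε hε
    have hset : MeasurableSet {x : ℝ | ε ≤ edist x 0} :=
      measurableSet_le measurable_const (measurable_id.edist measurable_const)
    have h := hmeasure ε hε
    have hconst : ∀ n, P {ω | ε ≤ edist (X (n + 1) ω) ((0 : Ω → ℝ) ω)} =
        P {ω | ε ≤ edist (X 0 ω) 0} := by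
      intro n
      have h1 := Measure.map_apply (μ := P) (hmeas (n + 1)) hset
      have h2 := Measure.map_apply (μ := P) (hmeas 0) hset
      rw [hident (n + 1), h2] at h1
      exact h1.symm
    simp only [hconst] at h
    exact tendsto_nhds_unique tendsto_const_nhds h
  have hall : ∀ᵐ ω ∂P, ∀ n : ℕ, ¬ ((n : ℝ≥0∞) + 1)⁻¹ ≤ edist (X 0 ω) 0 := by
    rw [ae_all_iff]
    intro n
    rw [ae_iff]
    simpa using hzero (((n : ℝ≥0∞) + 1)⁻¹) (by simp)
  filter_upwards [hall] with ω hω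
  by_contra h
  have hpos : edist (X 0 ω) 0 ≠ 0 := by simpa [edist_eq_zero] using h
  obtain ⟨n, hn⟩ := ENNReal.exists_inv_nat_lt hpos
  refine hω n (le_trans ?_ hn.le)
  exact ENNReal.inv_le_inv.2 le_self_add

/-- The expected positive parts of a random walk with nonnegative drift are nondecreasing. -/
theorem monotone_integral_posPart_sum (hmeas : ∀ n, Measurable (X n)) (hindep : iIndepFun X P)
    (hint : ∀ n, Integrable (X n) P) (hmean : ∀ n, 0 ≤ ∫ ω, X n ω ∂P) :
    Monotone fun n => ∫ ω, max (∑ s ∈ Finset.range (n + 1), X s ω) 0 ∂P := by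
  have hsub := (submartingale_sum_range_succ hmeas hindep hint hmean).pos
  intro m n hmn
  have := hsub.setIntegral_le hmn MeasurableSet.univ
  simpa [posPart_def] using this

end RandomWalk

/-! ### The maximum weight of a schedule and its mean over the link rates -/

namespace WirelessNetwork

variable {V W : Type*} [Fintype V] [Fintype W] (N : WirelessNetwork V W)

instance : IsProbabilityMeasure N.rateLaw := N.rate_isProbability

/-- The largest positive part of a backlog difference over a link. -/
noncomputable def gain (q : V → V ⊕ W → ℝ) (e : N.Link) : ℝ :=
  ⨆ c, max (q e.1.1 c - q e.1.2 c) 0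

theorem gain_nonneg (q : V → V ⊕ W → ℝ) (e : N.Link) : 0 ≤ N.gain q e :=
  Real.iSup_nonneg fun _ => le_max_right _ _

theorem max_sub_le_gain (q : V → V ⊕ W → ℝ) (e : N.Link) (c : V ⊕ W) :
    max (q e.1.1 c - q e.1.2 c) 0 ≤ N.gain q e :=
  le_ciSup (f := fun c => max (q e.1.1 c - q e.1.2 c) 0) (Set.finite_range _).bddAbove c

theorem sub_le_gain (q : V → V ⊕ W → ℝ) (e : N.Link) (c : V ⊕ W) :
    q e.1.1 c - q e.1.2 c ≤ N.gain q e :=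
  (le_max_left _ _).trans (N.max_sub_le_gain q e c)

theorem gain_le {q : V → V ⊕ W → ℝ} {e : N.Link} {b : ℝ} (hb : 0 ≤ b)
    (h : ∀ c, q e.1.1 c - q e.1.2 c ≤ b) : N.gain q e ≤ b :=
  Real.iSup_le (fun c => max_le (h c) hb) hb

theorem gain_smul {a : ℝ} (ha : 0 ≤ a) (q : V → V ⊕ W → ℝ) (e : N.Link) :
    N.gain (a • q) e = a * N.gain q e := by
  simp only [gain, Real.mul_iSup_of_nonneg ha, Pi.smul_apply, smul_eq_mul]
  refine iSup_congr fun c => ?_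
  rw [mul_max_of_nonneg _ _ ha]
  ring_nf

theorem gain_le_gain_add_dist (q q' : V → V ⊕ W → ℝ) (e : N.Link) :
    N.gain q e ≤ N.gain q' e + 2 * dist q q' := by
  refine N.gain_le (add_nonneg (N.gain_nonneg _ _) (by positivity)) fun c => ?_
  have h : ∀ i, |q i c - q' i c| ≤ dist q q' := fun i =>
    (dist_le_pi_dist (q i) (q' i) c).trans (dist_le_pi_dist q q' i)
  have h1 := abs_le.1 (h e.1.1)
  have h2 := abs_le.1 (h e.1.2)
  have h3 := N.sub_le_gain q' e c
  linarith [h1.2, h2.1]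

theorem gain_le_sum {q : V → V ⊕ W → ℝ} (hq : ∀ i c, 0 ≤ q i c) (e : N.Link) :
    N.gain q e ≤ ∑ i, ∑ c, q i c := by
  refine N.gain_le (Finset.sum_nonneg fun i _ => Finset.sum_nonneg fun c _ => hq i c) fun c => ?_
  have h1 : q e.1.1 c ≤ ∑ c, q e.1.1 c :=
    Finset.single_le_sum (fun c _ => hq e.1.1 c) (Finset.mem_univ c)
  have h2 : ∑ c, q e.1.1 c ≤ ∑ i, ∑ c, q i c :=
    Finset.single_le_sum (f := fun i => ∑ c, q i c)
      (fun i _ => Finset.sum_nonneg fun c _ => hq i c) (Finset.mem_univ _)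
  linarith [hq e.1.2 c]

theorem measurable_gain (e : N.Link) : Measurable fun q : V → V ⊕ W → ℝ => N.gain q e := by
  refine Measurable.iSup fun c => Measurable.max ?_ measurable_const
  fun_prop

/-- The schedules of the network. -/
abbrev Schedule : Type _ := {x : N.Link → ℝ // N.IsSchedule x}

instance : Finite N.Schedule := by
  refine Set.Finite.subset (s := {x : N.Link → ℝ | ∀ e, x e ∈ ({0, 1} : Set ℝ)})
    (Set.Finite.pi' fun e => Set.toFinite _) fun x hx e => ?_
  simpa using hx.1 e

theorem isSchedule_zero : N.IsSchedule 0 :=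
  ⟨fun _ => Or.inl rfl, fun _ _ _ => by simp⟩

instance : Nonempty N.Schedule := ⟨⟨0, N.isSchedule_zero⟩⟩

theorem isSchedule_single [DecidableEq N.Link] (e : N.Link) :
    N.IsSchedule (Pi.single e 1) := by
  refine ⟨fun f => ?_, fun f g hfg => ?_⟩
  · by_cases h : f = e
    · subst h; simp
    · simp [h]
  · have hne := hfg.ne
    by_cases h : f = e
    · subst h; simp [hne.symm]
    · by_cases h' : g = e
      · subst h'; simp [h]
      · simp [h, h']

variable {N} in
theorem IsSchedule.nonneg {x : N.Link → ℝ} (hx : N.IsSchedule x) (e : N.Link) : 0 ≤ x e := by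
  rcases hx.1 e with h | h <;> simp [h]

variable {N} in
theorem IsSchedule.le_one {x : N.Link → ℝ} (hx : N.IsSchedule x) (e : N.Link) : x e ≤ 1 := by
  rcases hx.1 e with h | h <;> simp [h]

/-- The largest total weight of a schedule when a link is weighted by its rate times the largest
backlog difference. -/
noncomputable def maxValue (q : V → V ⊕ W → ℝ) (r : N.Link → ℝ) : ℝ :=
  ⨆ x : N.Schedule, ∑ e, x.1 e * (r e * N.gain q e)

theorem le_maxValue (q : V → V ⊕ W → ℝ) (r : N.Link → ℝ) {x : N.Link → ℝ}
    (hx : N.IsSchedule x) : ∑ e, x e * (r e * N.gain q e) ≤ N.maxValue q r :=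
  le_ciSup (f := fun x : N.Schedule => ∑ e, x.1 e * (r e * N.gain q e))
    (Set.finite_range _).bddAbove ⟨x, hx⟩

theorem exists_maxValue_eq (q : V → V ⊕ W → ℝ) (r : N.Link → ℝ) :
    ∃ x, N.IsSchedule x ∧ N.maxValue q r = ∑ e, x e * (r e * N.gain q e) := by
  obtain ⟨x, hx⟩ := exists_eq_ciSup_of_finite
    (f := fun x : N.Schedule => ∑ e, x.1 e * (r e * N.gain q e))
  exact ⟨x.1, x.2, hx.symm⟩

theorem maxValue_nonneg (q : V → V ⊕ W → ℝ) (r : N.Link → ℝ) : 0 ≤ N.maxValue q r := by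
  simpa using N.le_maxValue q r N.isSchedule_zero

theorem measurable_maxValue :
    Measurable fun p : (V → V ⊕ W → ℝ) × (N.Link → ℝ) => N.maxValue p.1 p.2 := by
  refine Measurable.iSup fun x => Finset.measurable_fun_sum _ fun e _ => ?_
  have := N.measurable_gain e
  fun_prop

theorem maxValue_smul {a : ℝ} (ha : 0 ≤ a) (q : V → V ⊕ W → ℝ) (r : N.Link → ℝ) :
    N.maxValue (a • q) r = a * N.maxValue q r := by
  simp only [maxValue, Real.mul_iSup_of_nonneg ha, N.gain_smul ha, Finset.mul_sum]
  refine iSup_congr fun x => Finset.sum_congr rfl fun e _ => ?_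
  ring

theorem maxValue_le_sum {q : V → V ⊕ W → ℝ} {r : N.Link → ℝ} (hr : ∀ e, 0 ≤ r e) :
    N.maxValue q r ≤ ∑ e, r e * N.gain q e := by
  obtain ⟨x, hx, h⟩ := N.exists_maxValue_eq q r
  rw [h]
  refine Finset.sum_le_sum fun e _ => mul_le_of_le_one_left ?_ (hx.le_one e)
  exact mul_nonneg (hr e) (N.gain_nonneg q e)

theorem maxValue_mono {q q' : V → V ⊕ W → ℝ} {r : N.Link → ℝ} (hr : ∀ e, 0 ≤ r e)
    (h : ∀ e, N.gain q e ≤ N.gain q' e) : N.maxValue q r ≤ N.maxValue q' r := by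
  obtain ⟨x, hx, hxq⟩ := N.exists_maxValue_eq q r
  rw [hxq]
  refine (Finset.sum_le_sum fun e _ => ?_).trans (N.le_maxValue q' r hx)
  exact mul_le_mul_of_nonneg_left (mul_le_mul_of_nonneg_left (h e) (hr e)) (hx.nonneg e)

theorem maxValue_le_maxValue_add_dist (q q' : V → V ⊕ W → ℝ) {r : N.Link → ℝ}
    (hr : ∀ e, 0 ≤ r e) :
    N.maxValue q r ≤ N.maxValue q' r + 2 * dist q q' * ∑ e, r e := by
  obtain ⟨x, hx, hxq⟩ := N.exists_maxValue_eq q r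
  rw [hxq, Finset.mul_sum]
  refine le_trans ?_ (add_le_add_left (N.le_maxValue q' r hx) _)
  rw [← Finset.sum_add_distrib]
  refine Finset.sum_le_sum fun e _ => ?_
  have h1 := mul_le_mul_of_nonneg_left (N.gain_le_gain_add_dist q q' e)
    (mul_nonneg (hx.nonneg e) (hr e))
  have h2 : x e * (2 * dist q q' * r e) ≤ 2 * dist q q' * r e :=
    mul_le_of_le_one_left (mul_nonneg (by positivity) (hr e)) (hx.le_one e)
  nlinarith

theorem integrable_rate (e : N.Link) : Integrable (fun r : N.Link → ℝ => r e) N.rateLaw :=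
  (N.rate_memLp e).integrable one_le_two

theorem integrable_maxValue (q : V → V ⊕ W → ℝ) : Integrable (N.maxValue q) N.rateLaw := by
  refine Integrable.mono' (g := fun r => ∑ e, r e * N.gain q e)
    (integrable_finsetSum _ fun e _ => (N.integrable_rate e).mul_const _)
    (N.measurable_maxValue.comp measurable_prodMk_left).aestronglyMeasurable ?_
  filter_upwards [N.rate_nonneg] with r hr
  rw [Real.norm_of_nonneg (N.maxValue_nonneg q r)]
  exact N.maxValue_le_sum hr

/-- The mean of `maxValue` over the link rates. -/
noncomputable def meanValue (q : V → V ⊕ W → ℝ) : ℝ := ∫ r, N.maxValue q r ∂N.rateLaw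

theorem meanValue_smul {a : ℝ} (ha : 0 ≤ a) (q : V → V ⊕ W → ℝ) :
    N.meanValue (a • q) = a * N.meanValue q := by
  simp only [meanValue, N.maxValue_smul ha, integral_const_mul]

theorem meanValue_nonneg (q : V → V ⊕ W → ℝ) : 0 ≤ N.meanValue q :=
  integral_nonneg fun r => N.maxValue_nonneg q r

theorem meanValue_mono {q q' : V → V ⊕ W → ℝ} (h : ∀ e, N.gain q e ≤ N.gain q' e) :
    N.meanValue q ≤ N.meanValue q' := by
  refine integral_mono_ae (N.integrable_maxValue q) (N.integrable_maxValue q') ?_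
  filter_upwards [N.rate_nonneg] with r hr
  exact N.maxValue_mono hr h

/-- A change of `q` by `d` in the sup distance moves every gain by at most `2 * d`, hence the mean
value by at most `2 * d` times the mean total rate: the function is Lipschitz. -/
theorem continuous_meanValue : Continuous N.meanValue := by
  have hint : Integrable (fun r : N.Link → ℝ => ∑ e, r e) N.rateLaw :=
    integrable_finsetSum _ fun e _ => N.integrable_rate e
  have hR : 0 ≤ ∫ r : N.Link → ℝ, ∑ e, r e ∂N.rateLaw := by
    refine integral_nonneg_of_ae ?_
    filter_upwards [N.rate_nonneg] with r hr
    exact Finset.sum_nonneg fun e _ => hr e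
  refine LipschitzWith.continuous (K := (2 * ∫ r : N.Link → ℝ, ∑ e, r e ∂N.rateLaw).toNNReal)
    (LipschitzWith.of_le_add_mul _ fun q q' => ?_)
  rw [Real.coe_toNNReal _ (by positivity)]
  have h : N.meanValue q ≤
      ∫ r, (N.maxValue q' r + 2 * dist q q' * ∑ e, r e) ∂N.rateLaw := by
    refine integral_mono_ae (N.integrable_maxValue q)
      ((N.integrable_maxValue q').add (hint.const_mul _)) ?_
    filter_upwards [N.rate_nonneg] with r hr
    exact N.maxValue_le_maxValue_add_dist q q' hr
  rw [integral_add (N.integrable_maxValue q') (hint.const_mul _), integral_const_mul] at h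
  refine h.trans (le_of_eq ?_)
  rw [meanValue]
  ring

/-- Activating one link alone is a schedule, so the mean rate of that link times its gain is at most
the mean value; the mean rate is positive. -/
theorem gain_eq_zero_of_meanValue_nonpos {q : V → V ⊕ W → ℝ} (h : N.meanValue q ≤ 0)
    (e : N.Link) : N.gain q e = 0 := by
  classical
  have h1 : (∫ r, r e * N.gain q e ∂N.rateLaw) ≤ N.meanValue q := by
    refine integral_mono ((N.integrable_rate e).mul_const _) (N.integrable_maxValue q) fun r => ?_
    have := N.le_maxValue q r (N.isSchedule_single e)
    simpa [Pi.single_apply] using this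
  rw [integral_mul_const] at h1
  have h2 := N.rate_pos e
  have h3 := N.gain_nonneg q e
  by_contra hne
  have h4 := mul_pos h2 (lt_of_le_of_ne h3 (Ne.symm hne))
  linarith

/-- Queue states in the support of the commodities that can leave the network. -/
def IsHostedState (q : V → V ⊕ W → ℝ) : Prop :=
  (∀ i c, 0 ≤ q i c) ∧ (∀ i c, N.IsDestination i c → q i c = 0) ∧
    ∀ c, (∀ j, ¬ N.IsDestination j c) → ∀ i, q i c = 0

/-- With all gains zero, `q` cannot decrease along any link. Strong connectivity gives a path from
each device to a destination of the commodity, where `q` vanishes. -/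
theorem eq_zero_of_meanValue_nonpos {q : V → V ⊕ W → ℝ} (hq : N.IsHostedState q)
    (h : N.meanValue q ≤ 0) : q = 0 := by
  funext i c
  by_cases hc : ∃ j, N.IsDestination j c
  · obtain ⟨j, hj⟩ := hc
    have hle : ∀ k, Relation.ReflTransGen (fun a b => (a, b) ∈ N.links) i k → q i c ≤ q k c := by
      intro k hk
      induction hk with
      | refl => exact le_rfl
      | @tail b d _ hbd ih =>
        have h1 := N.sub_le_gain q ⟨(b, d), hbd⟩ c
        rw [N.gain_eq_zero_of_meanValue_nonpos h] at h1
        exact ih.trans (sub_nonpos.1 h1)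
    have hle := hle j (N.strongly_connected i j)
    rw [hq.2.1 j c hj] at hle
    exact le_antisymm hle (hq.1 i c)
  · push Not at hc
    exact hq.2.2 c hc i

theorem isClosed_setOf_isHostedState : IsClosed {q : V → V ⊕ W → ℝ | N.IsHostedState q} := by
  have hc : ∀ i c, Continuous fun q : V → V ⊕ W → ℝ => q i c := fun i c => by fun_prop
  simp only [IsHostedState, Set.ofPred_and, Set.ofPred_forall]
  refine IsClosed.inter ?_ (IsClosed.inter ?_ ?_)
  · exact isClosed_iInter fun i => isClosed_iInter fun c => isClosed_le continuous_const (hc i c)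
  · exact isClosed_iInter fun i => isClosed_iInter fun c => isClosed_iInter fun _ =>
      isClosed_eq (hc i c) continuous_const
  · exact isClosed_iInter fun c => isClosed_iInter fun _ => isClosed_iInter fun i =>
      isClosed_eq (hc i c) continuous_const

/-- If the arrival rates are strictly supported against every queue state, they are so
uniformly. -/
theorem exists_pos_forall_add_le_meanValue {lam : V → V ⊕ W → ℝ}
    (h : ∀ q, N.IsHostedState q → q ≠ 0 → ∑ i, ∑ c, q i c * lam i c < N.meanValue q) :
    ∃ ε > 0, ∀ q, N.IsHostedState q →
      ∑ i, ∑ c, q i c * lam i c + ε * ∑ i, ∑ c, q i c ≤ N.meanValue q := by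
  -- The slack is found on this compact slice and carried to all hosted states by homogeneity
  -- (`hscale`). If the slice is empty, only `q = 0` is hosted and any `ε` serves.
  set K : Set (V → V ⊕ W → ℝ) := {q | N.IsHostedState q} ∩ {q | ∑ i, ∑ c, q i c = 1} with hK
  have hcont : Continuous fun q : V → V ⊕ W → ℝ => ∑ i, ∑ c, q i c := by fun_prop
  have hsingle : ∀ q : V → V ⊕ W → ℝ, (∀ i c, 0 ≤ q i c) → ∀ i c, q i c ≤ ∑ i, ∑ c, q i c :=
    fun q hq i c => (Finset.single_le_sum (fun c _ => hq i c) (Finset.mem_univ c)).trans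
      (Finset.single_le_sum (f := fun i => ∑ c, q i c)
        (fun i _ => Finset.sum_nonneg fun c _ => hq i c) (Finset.mem_univ i))
  have hcompact : IsCompact K := by
    refine (isCompact_Icc (a := (0 : V → V ⊕ W → ℝ)) (b := 1)).of_isClosed_subset
      (N.isClosed_setOf_isHostedState.inter (isClosed_eq hcont continuous_const)) ?_
    rintro q ⟨hq, hq1⟩
    refine ⟨fun i c => hq.1 i c, fun i c => ?_⟩
    exact (hsingle q hq.1 i c).trans hq1.le
  have hscale : ∀ ε : ℝ, (∀ q ∈ K, ∑ i, ∑ c, q i c * lam i c + ε ≤ N.meanValue q) →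
      ∀ q, N.IsHostedState q →
        ∑ i, ∑ c, q i c * lam i c + ε * ∑ i, ∑ c, q i c ≤ N.meanValue q := by
    intro ε hε q hq
    set s := ∑ i, ∑ c, q i c with hs
    have hs0 : 0 ≤ s := Finset.sum_nonneg fun i _ => Finset.sum_nonneg fun c _ => hq.1 i c
    rcases hs0.eq_or_lt with h0 | hpos
    · have hq0 : q = 0 := by
        funext i c
        exact le_antisymm ((hsingle q hq.1 i c).trans h0.symm.le) (hq.1 i c)
      rw [← h0, hq0]
      simpa using N.meanValue_nonneg 0
    · have hmem : s⁻¹ • q ∈ K := by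
        refine ⟨⟨fun i c => ?_, fun i c hi => ?_, fun c hc i => ?_⟩, ?_⟩
        · exact mul_nonneg (inv_nonneg.2 hs0) (hq.1 i c)
        · simp [hq.2.1 i c hi]
        · simp [hq.2.2 c hc i]
        · simp only [Set.mem_ofPred_eq, Pi.smul_apply, smul_eq_mul, ← Finset.mul_sum]
          exact inv_mul_cancel₀ hpos.ne'
      have h1 := hε _ hmem
      rw [N.meanValue_smul (inv_nonneg.2 hs0)] at h1
      simp only [Pi.smul_apply, smul_eq_mul, mul_assoc, ← Finset.mul_sum] at h1
      have h2 := mul_le_mul_of_nonneg_left h1 hs0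
      rw [mul_add, ← mul_assoc, ← mul_assoc, mul_inv_cancel₀ hpos.ne'] at h2
      linarith
  rcases K.eq_empty_or_nonempty with hempty | hne
  · exact ⟨1, one_pos, hscale 1 fun q hq => by simp [hempty] at hq⟩
  · obtain ⟨q₀, hq₀, hmin⟩ := hcompact.exists_isMinOn hne
      (f := fun q => N.meanValue q - ∑ i, ∑ c, q i c * lam i c)
      (N.continuous_meanValue.sub (by fun_prop)).continuousOn
    refine ⟨_, sub_pos.2 (h q₀ hq₀.1 ?_), hscale _ fun q hq => ?_⟩
    · rintro rfl
      simpa using hq₀.2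
    · have := hmin hq
      simp only [Set.mem_ofPred_eq] at this
      linarith

end WirelessNetwork

/-! ### Decisions within one slot: feasibility and near-optimality of link sharing -/

namespace WirelessNetwork

variable {V W : Type*} [Fintype V] [Fintype W] (N : WirelessNetwork V W)

/-- `γ` respects the link rate `r` and the queues at the transmitter. -/
structure IsInitialAssignment (Q : V → V ⊕ W → ℝ) (e : N.Link) (r : ℝ) (γ : V ⊕ W → ℝ) : Prop where
  nonneg : ∀ c, 0 ≤ γ c
  sum_le : ∑ c, γ c ≤ r
  le_queue : ∀ c, γ c ≤ Q e.1.1 c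

/-- `μ` respects the schedule `x`, the link rates `r` and the queues at the transmitters. -/
structure IsFeasible (Q : V → V ⊕ W → ℝ) (r x : N.Link → ℝ) (μ : N.Link → V ⊕ W → ℝ) : Prop where
  isSchedule : N.IsSchedule x
  nonneg : ∀ e c, 0 ≤ μ e c
  sum_le : ∀ e, ∑ c, μ e c ≤ x e * r e
  le_queue : ∀ e c, μ e c ≤ x e * Q e.1.1 c

variable {N}

theorem IsExclusiveAssignment.isInitialAssignment {Q : V → V ⊕ W → ℝ} {e : N.Link} {r : ℝ}
    {γ : V ⊕ W → ℝ} (h : N.IsExclusiveAssignment Q e r γ) (hr : 0 ≤ r) (hQ : ∀ i c, 0 ≤ Q i c) :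
    N.IsInitialAssignment Q e r γ := by
  classical
  obtain ⟨c₀, -, hγ⟩ := h
  have hmin : ∀ c, 0 ≤ min r (Q e.1.1 c) := fun c => le_min hr (hQ _ c)
  refine ⟨fun c => ?_, ?_, fun c => ?_⟩
  · rw [hγ]
    split_ifs
    exacts [hmin c, le_rfl]
  · rw [Finset.sum_eq_single c₀]
    · rw [hγ]
      split_ifs
      exacts [min_le_left _ _, hr]
    · intro c _ hc
      rw [hγ, if_neg fun h => hc h.1]
    · simp
  · rw [hγ]
    split_ifs
    exacts [min_le_right _ _, hQ _ c]

theorem eligible_nonneg (Q : V → V ⊕ W → ℝ) (e : N.Link) (c : V ⊕ W) : 0 ≤ N.eligible Q e c := by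
  unfold eligible
  split_ifs <;> norm_num

theorem eligible_le_one (Q : V → V ⊕ W → ℝ) (e : N.Link) (c : V ⊕ W) : N.eligible Q e c ≤ 1 := by
  unfold eligible
  split_ifs <;> norm_num

theorem IsMaxUAssignment.nonneg {Q : V → V ⊕ W → ℝ} {e : N.Link} {r : ℝ}
    {γ : V ⊕ W → ℝ} (h : N.IsMaxUAssignment Q e r γ) (hQ : ∀ i c, 0 ≤ Q i c) (c : V ⊕ W) :
    0 ≤ γ c := by
  obtain ⟨σ, -, hγ⟩ := h
  obtain ⟨n, rfl⟩ := σ.surjective c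
  rw [hγ]
  exact le_min (mul_nonneg (eligible_nonneg _ _ _) (le_max_right _ _)) (hQ _ _)

theorem IsMaxUAssignment.isInitialAssignment {Q : V → V ⊕ W → ℝ} {e : N.Link} {r : ℝ}
    {γ : V ⊕ W → ℝ} (h : N.IsMaxUAssignment Q e r γ) (hr : 0 ≤ r) (hQ : ∀ i c, 0 ≤ Q i c) :
    N.IsInitialAssignment Q e r γ := by
  refine ⟨h.nonneg hQ, ?_, fun c => ?_⟩
  · obtain ⟨σ, -, hγ⟩ := h
    -- Prefix sums never exceed `r`: each new commodity gets at most the residual rate, which by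
    -- induction is nonnegative, so the truncation at `0` is inactive.
    have hprefix : ∀ k : ℕ,
        ∑ m ∈ Finset.univ.filter (fun m : Fin (Fintype.card (V ⊕ W)) => m.1 < k), γ (σ m) ≤ r := by
      intro k
      induction k with
      | zero => simpa using hr
      | succ k ih =>
        by_cases hk : k < Fintype.card (V ⊕ W)
        · have hset : Finset.univ.filter (fun m : Fin (Fintype.card (V ⊕ W)) => m.1 < k + 1) =
              insert ⟨k, hk⟩ (Finset.univ.filter fun m => m.1 < k) := by
            ext m
            simp only [Finset.mem_filter, Finset.mem_univ, true_and, Finset.mem_insert, Fin.ext_iff]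
            omega
          have hIio : Finset.Iio (⟨k, hk⟩ : Fin (Fintype.card (V ⊕ W))) =
              Finset.univ.filter fun m => m.1 < k := by
            ext m
            simp [Fin.lt_def]
          rw [hset, Finset.sum_insert (by simp), hγ, hIio]
          have h1 := min_le_left (N.eligible Q e (σ ⟨k, hk⟩) * max (r - ∑ m ∈ Finset.univ.filter
            (fun m : Fin (Fintype.card (V ⊕ W)) => m.1 < k), γ (σ m)) 0) (Q e.1.1 (σ ⟨k, hk⟩))
          rw [max_eq_left (sub_nonneg.2 ih)] at h1 ⊢
          have h2 := mul_le_of_le_one_left (sub_nonneg.2 ih) (eligible_le_one Q e (σ ⟨k, hk⟩))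
          linarith
        · refine le_trans (le_of_eq (Finset.sum_congr ?_ fun _ _ => rfl)) ih
          ext m
          have := m.2
          simp only [Finset.mem_filter, Finset.mem_univ, true_and]
          omega
    rw [← σ.sum_comp]
    simpa only [Fin.is_lt, Finset.filter_true] using hprefix (Fintype.card (V ⊕ W))
  · obtain ⟨σ, -, hγ⟩ := h
    obtain ⟨n, rfl⟩ := σ.surjective c
    rw [hγ]
    exact min_le_right _ _

theorem IsMaxUAssignment.eq_zero {Q : V → V ⊕ W → ℝ} {e : N.Link} {r : ℝ}
    {γ : V ⊕ W → ℝ} (h : N.IsMaxUAssignment Q e r γ) (hQ : ∀ i c, 0 ≤ Q i c) {c : V ⊕ W}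
    (hc : N.pressure Q e c ≤ 0) : γ c = 0 := by
  obtain ⟨σ, -, hγ⟩ := h
  obtain ⟨n, rfl⟩ := σ.surjective c
  rw [hγ, eligible, if_neg fun h => not_lt.2 hc h.1, zero_mul, min_eq_left (hQ _ _)]

variable (N) in
/-- The sum of all biases. -/
noncomputable def totalBias : ℝ := ∑ i, ∑ c, N.bias i c

theorem bias_le_totalBias (i : V) (c : V ⊕ W) : N.bias i c ≤ N.totalBias :=
  (Finset.single_le_sum (fun c _ => N.bias_nonneg i c) (Finset.mem_univ c)).trans
    (Finset.single_le_sum (f := fun i => ∑ c, N.bias i c)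
      (fun i _ => Finset.sum_nonneg fun c _ => N.bias_nonneg i c) (Finset.mem_univ i))

variable (N) in
theorem totalBias_nonneg : 0 ≤ N.totalBias :=
  Finset.sum_nonneg fun i _ => Finset.sum_nonneg fun c _ => N.bias_nonneg i c

theorem pressure_le {Q : V → V ⊕ W → ℝ} (hQ : ∀ i c, 0 ≤ Q i c) (e : N.Link) (c : V ⊕ W) :
    N.pressure Q e c ≤ Q e.1.1 c + N.totalBias := by
  have h1 := bias_le_totalBias (N := N) e.1.1 c
  have h2 := N.bias_nonneg e.1.2 c
  have h3 := hQ e.1.2 c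
  unfold pressure
  linarith

theorem sub_le_pressure_add (Q : V → V ⊕ W → ℝ) (e : N.Link) (c : V ⊕ W) :
    Q e.1.1 c - Q e.1.2 c ≤ N.pressure Q e c + N.totalBias := by
  have h1 := bias_le_totalBias (N := N) e.1.2 c
  have h2 := N.bias_nonneg e.1.1 c
  unfold pressure
  linarith

theorem pressure_le_sub_add (Q : V → V ⊕ W → ℝ) (e : N.Link) (c : V ⊕ W) :
    N.pressure Q e c ≤ Q e.1.1 c - Q e.1.2 c + N.totalBias := by
  have h1 := bias_le_totalBias (N := N) e.1.1 c
  have h2 := N.bias_nonneg e.1.2 c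
  unfold pressure
  linarith

/-- Link sharing attains the utility of spending the whole rate on any one commodity, up to an
error that does not depend on the queues. -/
theorem IsMaxUAssignment.rate_mul_pressure_le {Q : V → V ⊕ W → ℝ} {e : N.Link} {r : ℝ}
    {γ : V ⊕ W → ℝ} (h : N.IsMaxUAssignment Q e r γ) (hr : 0 ≤ r) (hQ : ∀ i c, 0 ≤ Q i c)
    (c : V ⊕ W) :
    r * max (N.pressure Q e c) 0 ≤
      ∑ c, γ c * max (N.pressure Q e c) 0 + r * (r + N.totalBias) := by
  have hγ0 := h.nonneg hQ
  have hB := N.totalBias_nonneg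
  have hU0 : 0 ≤ ∑ c, γ c * max (N.pressure Q e c) 0 :=
    Finset.sum_nonneg fun c _ => mul_nonneg (hγ0 c) (le_max_right _ _)
  -- Small pressures are absorbed by the error term. A larger one forces the transmitter queue above
  -- `r`, since pressure exceeds the queue by at most `totalBias`.
  by_cases hsmall : N.pressure Q e c ≤ r + N.totalBias
  · have := mul_le_mul_of_nonneg_left (max_le hsmall (add_nonneg hr hB)) hr
    linarith
  push Not at hsmall
  have hUpos : 0 < N.pressure Q e c := by linarith
  have hQr : r < Q e.1.1 c := by linarith [pressure_le hQ e c]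
  obtain ⟨σ, hanti, hγ⟩ := h
  obtain ⟨n, rfl⟩ := σ.surjective c
  have helig : N.eligible Q e (σ n) = 1 := if_pos ⟨hUpos, hr.trans_lt hQr⟩
  set s := ∑ m ∈ Finset.Iio n, γ (σ m) with hs
  -- The queue of this commodity exceeds `r`, so it takes all the rate still left at its turn: the
  -- rate is exhausted at position `n` or earlier.
  have hfill : r ≤ ∑ m ∈ Finset.Iic n, γ (σ m) := by
    rw [← Finset.Iio_insert, Finset.sum_insert (by simp), hγ, helig, one_mul, ← hs]
    have hs0 : 0 ≤ s := Finset.sum_nonneg fun m _ => hγ0 _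
    have : r - s ≤ min (max (r - s) 0) (Q e.1.1 (σ n)) :=
      le_min (le_max_left _ _) (by linarith)
    linarith
  have hle : ∀ m ∈ Finset.Iic n, N.pressure Q e (σ n) ≤ max (N.pressure Q e (σ m)) 0 := by
    intro m hm
    have h1 := hanti (Finset.mem_Iic.1 hm)
    simp only [helig, one_mul] at h1
    refine h1.trans ?_
    unfold eligible
    split_ifs <;> simp
  have h1 : r * N.pressure Q e (σ n) ≤
      ∑ m ∈ Finset.Iic n, γ (σ m) * max (N.pressure Q e (σ m)) 0 := by
    refine (mul_le_mul_of_nonneg_right hfill hUpos.le).trans ?_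
    rw [Finset.sum_mul]
    exact Finset.sum_le_sum fun m hm => mul_le_mul_of_nonneg_left (hle m hm) (hγ0 _)
  have h2 : ∑ m ∈ Finset.Iic n, γ (σ m) * max (N.pressure Q e (σ m)) 0 ≤
      ∑ c, γ c * max (N.pressure Q e c) 0 := by
    rw [← σ.sum_comp]
    exact Finset.sum_le_sum_of_subset_of_nonneg (Finset.subset_univ _)
      fun m _ _ => mul_nonneg (hγ0 _) (le_max_right _ _)
  rw [max_eq_left hUpos.le]
  have h3 : 0 ≤ r * (r + N.totalBias) := by positivity
  linarith

/-- Backlog differences exceed pressures by at most `totalBias`, which accounts for the second copy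
of it in the error. -/
theorem IsMaxUAssignment.rate_mul_gain_le {Q : V → V ⊕ W → ℝ} {e : N.Link} {r : ℝ}
    {γ : V ⊕ W → ℝ} (h : N.IsMaxUAssignment Q e r γ) (hr : 0 ≤ r) (hQ : ∀ i c, 0 ≤ Q i c) :
    r * N.gain Q e ≤
      ∑ c, γ c * max (N.pressure Q e c) 0 + r * (r + 2 * N.totalBias) := by
  have hB := N.totalBias_nonneg
  have hU0 : 0 ≤ ∑ c, γ c * max (N.pressure Q e c) 0 :=
    Finset.sum_nonneg fun c _ => mul_nonneg (h.nonneg hQ c) (le_max_right _ _)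
  rw [gain, Real.mul_iSup_of_nonneg hr]
  refine Real.iSup_le (fun c => ?_) (by positivity)
  have h1 := h.rate_mul_pressure_le hr hQ c
  have h2 : max (Q e.1.1 c - Q e.1.2 c) 0 ≤ max (N.pressure Q e c) 0 + N.totalBias :=
    max_le ((sub_le_pressure_add Q e c).trans (by gcongr; exact le_max_left _ _))
      (add_nonneg (le_max_right _ _) hB)
  have h3 := mul_le_mul_of_nonneg_left h2 hr
  linarith

theorem IsFinalAssignment.exists_isFeasible
    {Select : (V → V ⊕ W → ℝ) → N.Link → ℝ → (V ⊕ W → ℝ) → Prop} {Q : V → V ⊕ W → ℝ}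
    {r : N.Link → ℝ} {μ : N.Link → V ⊕ W → ℝ} (h : N.IsFinalAssignment Select Q r μ)
    (hSelect : ∀ e γ, Select Q e (r e) γ → N.IsInitialAssignment Q e (r e) γ) :
    ∃ x, N.IsFeasible Q r x μ := by
  obtain ⟨γ, x, hγ, hx, hμ⟩ := h
  have hx0 := hx.1.nonneg
  refine ⟨x, hx.1, fun e c => ?_, fun e => ?_, fun e c => ?_⟩
  · rw [hμ]
    exact mul_nonneg ((hSelect e _ (hγ e)).nonneg c) (hx0 e)
  · simp only [hμ, ← Finset.sum_mul]
    rw [mul_comm]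
    exact mul_le_mul_of_nonneg_left (hSelect e _ (hγ e)).sum_le (hx0 e)
  · rw [hμ, mul_comm]
    exact mul_le_mul_of_nonneg_left ((hSelect e _ (hγ e)).le_queue c) (hx0 e)

/-- The weighted backlog removed by a feasible assignment is at most the maximum weight. -/
theorem IsFeasible.sum_mul_sub_le {Q : V → V ⊕ W → ℝ} {r x : N.Link → ℝ}
    {μ : N.Link → V ⊕ W → ℝ} (h : N.IsFeasible Q r x μ) (q : V → V ⊕ W → ℝ) :
    ∑ e : N.Link, ∑ c, μ e c * (q e.1.1 c - q e.1.2 c) ≤ N.maxValue q r := by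
  refine le_trans (Finset.sum_le_sum fun e _ => ?_) (N.le_maxValue q r h.isSchedule)
  rw [← mul_assoc]
  refine le_trans (Finset.sum_le_sum fun c _ =>
    mul_le_mul_of_nonneg_left (N.sub_le_gain q e c) (h.nonneg e c)) ?_
  rw [← Finset.sum_mul]
  exact mul_le_mul_of_nonneg_right (h.sum_le e) (N.gain_nonneg q e)

theorem IsFeasible.sum_le_rate {Q : V → V ⊕ W → ℝ} {r x : N.Link → ℝ}
    {μ : N.Link → V ⊕ W → ℝ} (h : N.IsFeasible Q r x μ) (hr : ∀ e, 0 ≤ r e) (e : N.Link) :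
    ∑ c, μ e c ≤ r e :=
  (h.sum_le e).trans (mul_le_of_le_one_left (hr e) (h.isSchedule.le_one e))

theorem IsFeasible.le_rate {Q : V → V ⊕ W → ℝ} {r x : N.Link → ℝ}
    {μ : N.Link → V ⊕ W → ℝ} (h : N.IsFeasible Q r x μ) (hr : ∀ e, 0 ≤ r e) (e : N.Link)
    (c : V ⊕ W) : μ e c ≤ r e :=
  (Finset.single_le_sum (fun c _ => h.nonneg e c) (Finset.mem_univ c)).trans (h.sum_le_rate hr e)

/-- Link sharing with MaxWeight scheduling removes the maximum weight, up to an error that does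
not depend on the queues. -/
theorem IsFinalAssignment.maxValue_le {Q : V → V ⊕ W → ℝ} {r : N.Link → ℝ}
    {μ : N.Link → V ⊕ W → ℝ} (h : N.IsFinalAssignment N.IsMaxUAssignment Q r μ)
    (hr : ∀ e, 0 ≤ r e) (hQ : ∀ i c, 0 ≤ Q i c) :
    N.maxValue Q r ≤ ∑ e : N.Link, ∑ c, μ e c * (Q e.1.1 c - Q e.1.2 c) +
      ∑ e, r e * (r e + 3 * N.totalBias) := by
  obtain ⟨γ, x, hγ, hx, hμ⟩ := h
  have hB := N.totalBias_nonneg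
  obtain ⟨y, hy, hyQ⟩ := N.exists_maxValue_eq Q r
  have h1 : ∑ e, y e * (r e * N.gain Q e) ≤
      ∑ e, y e * N.utility Q γ e + ∑ e, r e * (r e + 2 * N.totalBias) := by
    rw [← Finset.sum_add_distrib]
    refine Finset.sum_le_sum fun e _ => ?_
    have h2 := mul_le_mul_of_nonneg_left ((hγ e).rate_mul_gain_le (hr e) hQ) (hy.nonneg e)
    rw [mul_add] at h2
    have h3 := mul_le_of_le_one_left (a := y e)
      (mul_nonneg (hr e) (add_nonneg (hr e) (by positivity : 0 ≤ 2 * N.totalBias))) (hy.le_one e)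
    rw [utility]
    linarith
  have h4 : ∑ e, x e * N.utility Q γ e ≤
      ∑ e : N.Link, ∑ c, μ e c * (Q e.1.1 c - Q e.1.2 c) + ∑ e, r e * N.totalBias := by
    rw [← Finset.sum_add_distrib]
    refine Finset.sum_le_sum fun e _ => ?_
    have hin := (hγ e).isInitialAssignment (hr e) hQ
    have hx0 := hx.1.nonneg e
    have h5 : N.utility Q γ e ≤
        ∑ c, γ e c * (Q e.1.1 c - Q e.1.2 c) + (∑ c, γ e c) * N.totalBias := by
      rw [utility, Finset.sum_mul, ← Finset.sum_add_distrib]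
      refine Finset.sum_le_sum fun c _ => ?_
      rcases le_total (N.pressure Q e c) 0 with hp | hp
      -- The filter matters here: rate given to a commodity of negative pressure would add nothing
      -- to the utility but could make the right-hand side very negative.
      · simp [(hγ e).eq_zero hQ hp]
      · rw [max_eq_left hp, ← mul_add]
        exact mul_le_mul_of_nonneg_left (pressure_le_sub_add Q e c) (hin.nonneg c)
    have h6 := mul_le_mul_of_nonneg_left h5 hx0
    have h7 : x e * ((∑ c, γ e c) * N.totalBias) ≤ r e * N.totalBias := by
      refine (mul_le_of_le_one_left (mul_nonneg (Finset.sum_nonneg fun c _ => hin.nonneg c) hB)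
        (hx.1.le_one e)).trans (mul_le_mul_of_nonneg_right hin.sum_le hB)
    have h8 : ∑ c, μ e c * (Q e.1.1 c - Q e.1.2 c) =
        x e * ∑ c, γ e c * (Q e.1.1 c - Q e.1.2 c) := by
      rw [Finset.mul_sum]
      refine Finset.sum_congr rfl fun c _ => ?_
      rw [hμ]
      ring
    rw [h8]
    linarith
  have h9 := hx.2 y hy
  -- Two copies of `totalBias` come from comparing gains with utilities on the optimal schedule `y`,
  -- the third from returning from utilities to backlog differences on the chosen schedule `x`.
  -- MaxWeight optimality (`h9`) links the two.
  have h10 : ∑ e, r e * (r e + 3 * N.totalBias) =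
      ∑ e, r e * (r e + 2 * N.totalBias) + ∑ e, r e * N.totalBias := by
    rw [← Finset.sum_add_distrib]
    exact Finset.sum_congr rfl fun e _ => by ring
  rw [hyQ, h10]
  linarith

open Classical in
variable (N) in
/-- The rate at which a commodity leaves a device. -/
noncomputable def outflow (μ : N.Link → V ⊕ W → ℝ) (i : V) (c : V ⊕ W) : ℝ :=
  ∑ e : N.Link, if e.1.1 = i then μ e c else 0

open Classical in
variable (N) in
/-- The rate at which a commodity is forwarded to a device. -/
noncomputable def inflow (μ : N.Link → V ⊕ W → ℝ) (i : V) (c : V ⊕ W) : ℝ :=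
  ∑ e : N.Link, if e.1.2 = i then μ e c else 0

theorem sum_mul_outflow (q : V → V ⊕ W → ℝ) (μ : N.Link → V ⊕ W → ℝ) :
    ∑ i, ∑ c, q i c * N.outflow μ i c = ∑ e : N.Link, ∑ c, μ e c * q e.1.1 c := by
  classical
  have h : ∀ i c, q i c * N.outflow μ i c =
      ∑ e : N.Link, if e.1.1 = i then μ e c * q i c else 0 := fun i c => by
    rw [outflow, Finset.mul_sum]
    exact Finset.sum_congr rfl fun e _ => by split_ifs <;> ring
  simp only [h]
  rw [Finset.sum_congr rfl fun i _ => Finset.sum_comm, Finset.sum_comm]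
  refine Finset.sum_congr rfl fun e _ => ?_
  rw [Finset.sum_comm]
  exact Finset.sum_congr rfl fun c _ => by simp

theorem sum_mul_inflow (q : V → V ⊕ W → ℝ) (μ : N.Link → V ⊕ W → ℝ) :
    ∑ i, ∑ c, q i c * N.inflow μ i c = ∑ e : N.Link, ∑ c, μ e c * q e.1.2 c := by
  classical
  have h : ∀ i c, q i c * N.inflow μ i c =
      ∑ e : N.Link, if e.1.2 = i then μ e c * q i c else 0 := fun i c => by
    rw [inflow, Finset.mul_sum]
    exact Finset.sum_congr rfl fun e _ => by split_ifs <;> ring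
  simp only [h]
  rw [Finset.sum_congr rfl fun i _ => Finset.sum_comm, Finset.sum_comm]
  refine Finset.sum_congr rfl fun e _ => ?_
  rw [Finset.sum_comm]
  exact Finset.sum_congr rfl fun c _ => by simp

theorem IsFeasible.outflow_nonneg {Q : V → V ⊕ W → ℝ} {r x : N.Link → ℝ}
    {μ : N.Link → V ⊕ W → ℝ} (h : N.IsFeasible Q r x μ) (i : V) (c : V ⊕ W) :
    0 ≤ N.outflow μ i c :=
  Finset.sum_nonneg fun e _ => by split_ifs; exacts [h.nonneg e c, le_rfl]

theorem IsFeasible.inflow_nonneg {Q : V → V ⊕ W → ℝ} {r x : N.Link → ℝ}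
    {μ : N.Link → V ⊕ W → ℝ} (h : N.IsFeasible Q r x μ) (i : V) (c : V ⊕ W) :
    0 ≤ N.inflow μ i c :=
  Finset.sum_nonneg fun e _ => by split_ifs; exacts [h.nonneg e c, le_rfl]

theorem IsFeasible.outflow_le_rate {Q : V → V ⊕ W → ℝ} {r x : N.Link → ℝ}
    {μ : N.Link → V ⊕ W → ℝ} (h : N.IsFeasible Q r x μ) (hr : ∀ e, 0 ≤ r e) (i : V)
    (c : V ⊕ W) : N.outflow μ i c ≤ ∑ e, r e :=
  Finset.sum_le_sum fun e _ => by split_ifs; exacts [h.le_rate hr e c, hr e]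

theorem IsFeasible.inflow_le_rate {Q : V → V ⊕ W → ℝ} {r x : N.Link → ℝ}
    {μ : N.Link → V ⊕ W → ℝ} (h : N.IsFeasible Q r x μ) (hr : ∀ e, 0 ≤ r e) (i : V)
    (c : V ⊕ W) : N.inflow μ i c ≤ ∑ e, r e :=
  Finset.sum_le_sum fun e _ => by split_ifs; exacts [h.le_rate hr e c, hr e]

/-- Interface conflicts keep a device from sending more than it holds. -/
theorem IsFeasible.outflow_le {Q : V → V ⊕ W → ℝ} {r x : N.Link → ℝ}
    {μ : N.Link → V ⊕ W → ℝ} (h : N.IsFeasible Q r x μ) (hQ : ∀ i c, 0 ≤ Q i c) (i : V)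
    (c : V ⊕ W) : N.outflow μ i c ≤ Q i c := by
  classical
  by_cases hact : ∃ e : N.Link, e.1.1 = i ∧ x e = 1
  · obtain ⟨e, he, hxe⟩ := hact
    rw [outflow, Finset.sum_eq_single e]
    · rw [if_pos he]
      have := h.le_queue e c
      rwa [hxe, one_mul, he] at this
    · intro f _ hfe
      split_ifs with hf
      · have hconf := h.isSchedule.2 f e (N.interface_conflict f e hfe (hf.trans he.symm))
        have hxf : x f = 0 := le_antisymm (by linarith) (h.isSchedule.nonneg f)
        have := h.le_queue f c
        rw [hxf, zero_mul] at this
        exact le_antisymm this (h.nonneg f c)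
      · rfl
    · simp
  · push Not at hact
    refine le_trans (le_of_eq (Finset.sum_eq_zero fun e _ => ?_)) (hQ i c)
    split_ifs with he
    · have hx0 : x e = 0 := (h.isSchedule.1 e).resolve_right (hact e he)
      have := h.le_queue e c
      rw [hx0, zero_mul] at this
      exact le_antisymm this (h.nonneg e c)
    · rfl

end WirelessNetwork

/-! ### Queue dynamics along a sample path -/

namespace WirelessNetwork

variable {V W : Type*} [Fintype V] [Fintype W] {N : WirelessNetwork V W}

variable (N) in
/-- Nonnegative queue states with no packets at their destinations. -/
def IsQueueState (Q : V → V ⊕ W → ℝ) : Prop :=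
  (∀ i c, 0 ≤ Q i c) ∧ ∀ i c, N.IsDestination i c → Q i c = 0

variable (N) in
/-- A measurable policy whose decisions respect the link rates, the queues and the conflicts. -/
def IsFeasiblePolicy (π : N.Policy) : Prop :=
  (∀ t, Measurable fun p : (N.Link → ℝ) × (V → V ⊕ W → ℝ) => π t p.1 p.2) ∧
    ∀ t r Q, (∀ e, 0 ≤ r e) → N.IsQueueState Q → ∃ x, N.IsFeasible Q r x (π t r Q)

theorem IsClassicSPBP.isFeasiblePolicy {π : N.Policy} (h : N.IsClassicSPBP π) :
    N.IsFeasiblePolicy π :=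
  ⟨h.1, fun t r Q hr hQ => (h.2 t r Q hr hQ.1 hQ.2).exists_isFeasible
    fun e _ hγ => hγ.isInitialAssignment (hr e) hQ.1⟩

theorem IsMaxUSPBP.isFeasiblePolicy {π : N.Policy} (h : N.IsMaxUSPBP π) :
    N.IsFeasiblePolicy π :=
  ⟨h.1, fun t r Q hr hQ => (h.2 t r Q hr hQ.1 hQ.2).exists_isFeasible
    fun e _ hγ => hγ.isInitialAssignment (hr e) hQ.1⟩

variable (N) in
/-- Sample paths with nonnegative arrivals and link rates. -/
def IsNonnegPath (ω : ℕ → (V → V ⊕ W → ℝ) × (N.Link → ℝ)) : Prop :=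
  ∀ t, (∀ i c, 0 ≤ (ω t).1 i c) ∧ ∀ e, 0 ≤ (ω t).2 e

section Path

variable {π : N.Policy} {Q₀ : V → V ⊕ W → ℝ} {ω : ℕ → (V → V ⊕ W → ℝ) × (N.Link → ℝ)}

theorem queue_succ_of_isDestination {i : V} {c : V ⊕ W} (h : N.IsDestination i c) (t : ℕ) :
    N.queue π Q₀ ω (t + 1) i c = 0 :=
  if_pos h

theorem queue_succ_of_not_isDestination {i : V} {c : V ⊕ W} (h : ¬ N.IsDestination i c) (t : ℕ) :
    N.queue π Q₀ ω (t + 1) i c = N.queue π Q₀ ω t i c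
      - N.outflow (π t (ω t).2 (N.queue π Q₀ ω t)) i c
      + N.inflow (π t (ω t).2 (N.queue π Q₀ ω t)) i c + (ω t).1 i c :=
  if_neg h

theorem isQueueState_queue (hπ : N.IsFeasiblePolicy π) (hQ₀ : N.IsQueueState Q₀)
    (hω : N.IsNonnegPath ω) (t : ℕ) : N.IsQueueState (N.queue π Q₀ ω t) := by
  induction t with
  | zero => exact hQ₀
  | succ t ih =>
    refine ⟨fun i c => ?_, fun i c hi => queue_succ_of_isDestination hi t⟩
    by_cases hi : N.IsDestination i c
    · exact (queue_succ_of_isDestination hi t).ge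
    · obtain ⟨x, hx⟩ := hπ.2 t _ _ (hω t).2 ih
      rw [queue_succ_of_not_isDestination hi]
      have h1 := hx.outflow_le ih.1 i c
      have h2 := hx.inflow_nonneg i c
      have h3 := (hω t).1 i c
      linarith

theorem queue_succ_le (hπ : N.IsFeasiblePolicy π) (hQ₀ : N.IsQueueState Q₀)
    (hω : N.IsNonnegPath ω) (t : ℕ) (i : V) (c : V ⊕ W) :
    N.queue π Q₀ ω (t + 1) i c ≤ N.queue π Q₀ ω t i c + ∑ e, (ω t).2 e + (ω t).1 i c := by
  have hQ := isQueueState_queue hπ hQ₀ hω t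
  obtain ⟨x, hx⟩ := hπ.2 t _ _ (hω t).2 hQ
  by_cases hi : N.IsDestination i c
  · rw [queue_succ_of_isDestination hi]
    exact add_nonneg (add_nonneg (hQ.1 i c) (Finset.sum_nonneg fun e _ => (hω t).2 e))
      ((hω t).1 i c)
  · rw [queue_succ_of_not_isDestination hi]
    have h1 := hx.outflow_nonneg i c
    have h2 := hx.inflow_le_rate (hω t).2 i c
    linarith

theorem sum_mul_queue_succ {q : V → V ⊕ W → ℝ} (hq : ∀ i c, N.IsDestination i c → q i c = 0)
    (t : ℕ) :
    ∑ i, ∑ c, q i c * N.queue π Q₀ ω (t + 1) i c =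
      ∑ i, ∑ c, q i c * N.queue π Q₀ ω t i c + ∑ i, ∑ c, q i c * (ω t).1 i c -
        ∑ e : N.Link, ∑ c, π t (ω t).2 (N.queue π Q₀ ω t) e c * (q e.1.1 c - q e.1.2 c) := by
  set μ := π t (ω t).2 (N.queue π Q₀ ω t) with hμ
  have h : ∀ i c, q i c * N.queue π Q₀ ω (t + 1) i c =
      q i c * N.queue π Q₀ ω t i c + q i c * (ω t).1 i c -
        (q i c * N.outflow μ i c - q i c * N.inflow μ i c) := fun i c => by
    by_cases hi : N.IsDestination i c
    · simp [hq i c hi]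
    · rw [queue_succ_of_not_isDestination hi]
      ring
  simp only [h, Finset.sum_add_distrib, Finset.sum_sub_distrib, sum_mul_outflow, sum_mul_inflow,
    mul_sub]

/-- The weighted backlog decreases by at most the maximum weight of a schedule. -/
theorem sum_mul_queue_succ_ge (hπ : N.IsFeasiblePolicy π) (hQ₀ : N.IsQueueState Q₀)
    (hω : N.IsNonnegPath ω) {q : V → V ⊕ W → ℝ}
    (hq : ∀ i c, N.IsDestination i c → q i c = 0) (t : ℕ) :
    ∑ i, ∑ c, q i c * N.queue π Q₀ ω t i c +
        (∑ i, ∑ c, q i c * (ω t).1 i c - N.maxValue q (ω t).2) ≤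
      ∑ i, ∑ c, q i c * N.queue π Q₀ ω (t + 1) i c := by
  obtain ⟨x, hx⟩ := hπ.2 t _ _ (hω t).2 (isQueueState_queue hπ hQ₀ hω t)
  have := hx.sum_mul_sub_le q
  rw [sum_mul_queue_succ hq]
  linarith

/-- The weighted backlog dominates a random walk. -/
theorem sum_range_le_sum_mul_queue (hπ : N.IsFeasiblePolicy π) (hQ₀ : N.IsQueueState Q₀)
    (hω : N.IsNonnegPath ω) {q : V → V ⊕ W → ℝ} (hq0 : ∀ i c, 0 ≤ q i c)
    (hq : ∀ i c, N.IsDestination i c → q i c = 0) (t : ℕ) :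
    ∑ s ∈ Finset.range t, (∑ i, ∑ c, q i c * (ω s).1 i c - N.maxValue q (ω s).2) ≤
      ∑ i, ∑ c, q i c * N.queue π Q₀ ω t i c := by
  induction t with
  | zero =>
    rw [Finset.sum_range_zero]
    exact Finset.sum_nonneg fun i _ => Finset.sum_nonneg fun c _ =>
      mul_nonneg (hq0 i c) (hQ₀.1 i c)
  | succ t ih =>
    rw [Finset.sum_range_succ]
    have := sum_mul_queue_succ_ge hπ hQ₀ hω hq t
    linarith

/-- Expanding the square, the net increment lies between minus the total rate and the total rate
plus the arrivals, so its square is bounded independently of the queues. At a destination all terms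
with the queue vanish. -/
theorem queue_succ_sq_le (hπ : N.IsFeasiblePolicy π) (hQ₀ : N.IsQueueState Q₀)
    (hω : N.IsNonnegPath ω) (t : ℕ) (i : V) (c : V ⊕ W) :
    N.queue π Q₀ ω (t + 1) i c ^ 2 ≤
      N.queue π Q₀ ω t i c ^ 2 + 2 * (N.queue π Q₀ ω t i c * (ω t).1 i c) -
        2 * (N.queue π Q₀ ω t i c * N.outflow (π t (ω t).2 (N.queue π Q₀ ω t)) i c) +
        2 * (N.queue π Q₀ ω t i c * N.inflow (π t (ω t).2 (N.queue π Q₀ ω t)) i c) +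
        (∑ e, (ω t).2 e + (ω t).1 i c) ^ 2 := by
  have hQ := isQueueState_queue hπ hQ₀ hω t
  obtain ⟨x, hx⟩ := hπ.2 t _ _ (hω t).2 hQ
  by_cases hi : N.IsDestination i c
  · rw [queue_succ_of_isDestination hi, hQ.2 i c hi]
    have := sq_nonneg (∑ e, (ω t).2 e + (ω t).1 i c)
    linarith
  · rw [queue_succ_of_not_isDestination hi]
    have h1 := hx.outflow_nonneg i c
    have h2 := hx.inflow_le_rate (hω t).2 i c
    have h3 := hx.outflow_le_rate (hω t).2 i c
    have h4 := hx.inflow_nonneg i c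
    have h5 := (hω t).1 i c
    set o := N.outflow (π t (ω t).2 (N.queue π Q₀ ω t)) i c
    set f := N.inflow (π t (ω t).2 (N.queue π Q₀ ω t)) i c
    have h6 : (-o + f + (ω t).1 i c) ^ 2 ≤ (∑ e, (ω t).2 e + (ω t).1 i c) ^ 2 :=
      sq_le_sq' (by linarith) (by linarith)
    linarith [h6, sq (N.queue π Q₀ ω t i c - o + f + (ω t).1 i c), sq (-o + f + (ω t).1 i c),
      sq (N.queue π Q₀ ω t i c)]

variable (N) in
/-- The part of the quadratic drift that does not depend on the queues. -/
noncomputable def driftConstant (y : (V → V ⊕ W → ℝ) × (N.Link → ℝ)) : ℝ :=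
  ∑ i, ∑ c, (∑ e, y.2 e + y.1 i c) ^ 2 + 2 * ∑ e, y.2 e * (y.2 e + 3 * N.totalBias)

theorem IsMaxUSPBP.sum_queue_succ_sq_le (hπ : N.IsMaxUSPBP π) (hQ₀ : N.IsQueueState Q₀)
    (hω : N.IsNonnegPath ω) (t : ℕ) :
    ∑ i, ∑ c, N.queue π Q₀ ω (t + 1) i c ^ 2 ≤
      ∑ i, ∑ c, N.queue π Q₀ ω t i c ^ 2 + 2 * ∑ i, ∑ c, N.queue π Q₀ ω t i c * (ω t).1 i c -
        2 * N.maxValue (N.queue π Q₀ ω t) (ω t).2 + N.driftConstant (ω t) := by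
  have hQ := isQueueState_queue hπ.isFeasiblePolicy hQ₀ hω t
  have h1 := (hπ.2 t _ _ (hω t).2 hQ.1 hQ.2).maxValue_le (hω t).2 hQ.1
  have h2 := Finset.sum_le_sum fun i (_ : i ∈ Finset.univ) => Finset.sum_le_sum
    fun c (_ : c ∈ Finset.univ) => queue_succ_sq_le hπ.isFeasiblePolicy hQ₀ hω t i c
  simp only [Finset.sum_add_distrib, Finset.sum_sub_distrib, ← Finset.mul_sum, sum_mul_outflow,
    sum_mul_inflow] at h2
  simp only [mul_sub, Finset.sum_sub_distrib] at h1
  rw [driftConstant]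
  linarith

/-- A commodity without destinations stays in the network. -/
theorem sum_queue_succ_of_forall_not_isDestination {c : V ⊕ W}
    (hc : ∀ j, ¬ N.IsDestination j c) (t : ℕ) :
    ∑ i, N.queue π Q₀ ω (t + 1) i c = ∑ i, N.queue π Q₀ ω t i c + ∑ i, (ω t).1 i c := by
  classical
  -- The weight is the indicator of `c`, constant over devices, so forwarding leaves the weighted
  -- backlog unchanged.
  have h := sum_mul_queue_succ (N := N) (π := π) (Q₀ := Q₀) (ω := ω)
    (q := fun _ c' => if c' = c then 1 else 0)
    (fun i c' hi => if_neg fun h' => hc i (by rwa [h'] at hi)) t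
  simpa only [ite_mul, one_mul, zero_mul, Finset.sum_ite_eq', Finset.mem_univ, if_true, sub_self,
    mul_zero, Finset.sum_const_zero, sub_zero] using h

theorem queue_congr {ω' : ℕ → (V → V ⊕ W → ℝ) × (N.Link → ℝ)} {t : ℕ}
    (h : ∀ s < t, ω s = ω' s) : N.queue π Q₀ ω t = N.queue π Q₀ ω' t := by
  induction t with
  | zero => rfl
  | succ t ih =>
    have ih := ih fun s hs => h s (hs.trans (Nat.lt_succ_self t))
    simp only [queue, ih, h t (Nat.lt_succ_self t)]

end Path

section Hosted

open Classical in
variable (N) in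
/-- The part of a queue state that belongs to commodities with a destination. -/
noncomputable def hostedPart (q : V → V ⊕ W → ℝ) : V → V ⊕ W → ℝ :=
  fun i c => if ∃ j, N.IsDestination j c then q i c else 0

theorem hostedPart_of_exists {c : V ⊕ W} (hc : ∃ j, N.IsDestination j c) (q : V → V ⊕ W → ℝ)
    (i : V) : N.hostedPart q i c = q i c :=
  if_pos hc

theorem hostedPart_of_not_exists {c : V ⊕ W} (hc : ¬ ∃ j, N.IsDestination j c)
    (q : V → V ⊕ W → ℝ) (i : V) : N.hostedPart q i c = 0 :=
  if_neg hc

theorem IsQueueState.isHostedState_hostedPart {q : V → V ⊕ W → ℝ} (hq : N.IsQueueState q) :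
    N.IsHostedState (N.hostedPart q) := by
  refine ⟨fun i c => ?_, fun i c hi => ?_, fun c hc i => ?_⟩
  · unfold hostedPart
    split_ifs
    exacts [hq.1 i c, le_rfl]
  · rw [hostedPart_of_exists ⟨i, hi⟩, hq.2 i c hi]
  · exact hostedPart_of_not_exists (not_exists.2 hc) q i

/-- The slack inequality covers hosted states only. Discarding the other commodities does not raise
any gain, so the bound for the hosted part transfers to the full queue state. -/
theorem gain_hostedPart_le (q : V → V ⊕ W → ℝ) (e : N.Link) :
    N.gain (N.hostedPart q) e ≤ N.gain q e := by
  refine N.gain_le (N.gain_nonneg q e) fun c => ?_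
  unfold hostedPart
  split_ifs
  · exact N.sub_le_gain q e c
  · simpa using N.gain_nonneg q e

end Hosted

end WirelessNetwork

/-! ### Measurability, moments and independence of the queues -/

namespace WirelessNetwork

open ProbabilityTheory

variable {V W : Type*} [Fintype V] [Fintype W] {N : WirelessNetwork V W}
  {π : N.Policy} {Q₀ lam : V → V ⊕ W → ℝ} {ν : Measure (V → V ⊕ W → ℝ)}

theorem measurable_queue (hπ : N.IsFeasiblePolicy π) (t : ℕ) :
    Measurable fun ω => N.queue π Q₀ ω t := by
  induction t with
  | zero => exact measurable_const
  | succ t ih =>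
    have hμ : Measurable fun ω : ℕ → (V → V ⊕ W → ℝ) × (N.Link → ℝ) =>
        π t (ω t).2 (N.queue π Q₀ ω t) :=
      (hπ.1 t).comp ((measurable_snd.comp (measurable_pi_apply t)).prodMk ih)
    have hμ' : ∀ e c, Measurable fun ω : ℕ → (V → V ⊕ W → ℝ) × (N.Link → ℝ) =>
        π t (ω t).2 (N.queue π Q₀ ω t) e c := fun e c =>
      (measurable_pi_apply c).comp ((measurable_pi_apply e).comp hμ)
    have hA : ∀ i c, Measurable fun ω : ℕ → (V → V ⊕ W → ℝ) × (N.Link → ℝ) => (ω t).1 i c :=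
      fun i c => by fun_prop
    have hQ : ∀ i c, Measurable fun ω : ℕ → (V → V ⊕ W → ℝ) × (N.Link → ℝ) =>
        N.queue π Q₀ ω t i c := fun i c =>
      (measurable_pi_apply c).comp ((measurable_pi_apply i).comp ih)
    refine measurable_pi_iff.2 fun i => measurable_pi_iff.2 fun c => ?_
    by_cases hi : N.IsDestination i c
    · simp only [queue_succ_of_isDestination hi]
      exact measurable_const
    · simp only [queue_succ_of_not_isDestination hi, outflow, inflow]
      refine (((hQ i c).sub ?_).add ?_).add (hA i c) <;>
      · refine Finset.measurable_fun_sum _ fun e _ => ?_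
        split_ifs
        exacts [hμ' e c, measurable_const]

theorem measurable_queue_apply (hπ : N.IsFeasiblePolicy π) (t : ℕ) (i : V) (c : V ⊕ W) :
    Measurable fun ω => N.queue π Q₀ ω t i c :=
  (measurable_pi_apply c).comp ((measurable_pi_apply i).comp (measurable_queue hπ t))

instance [IsProbabilityMeasure ν] : IsProbabilityMeasure (N.processLaw ν) := by
  unfold processLaw
  infer_instance

theorem map_eval_processLaw [IsProbabilityMeasure ν] (t : ℕ) :
    (N.processLaw ν).map (fun ω => ω t) = ν.prod N.rateLaw :=
  Measure.infinitePi_map_eval (fun _ => ν.prod N.rateLaw) t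

theorem measurePreserving_eval [IsProbabilityMeasure ν] (t : ℕ) :
    MeasurePreserving (fun ω => ω t) (N.processLaw ν) (ν.prod N.rateLaw) :=
  ⟨measurable_pi_apply t, map_eval_processLaw t⟩

theorem measurePreserving_arrival [IsProbabilityMeasure ν] (t : ℕ) :
    MeasurePreserving (fun ω => (ω t).1) (N.processLaw ν) ν :=
  measurePreserving_fst.comp (measurePreserving_eval t)

theorem measurePreserving_rate [IsProbabilityMeasure ν] (t : ℕ) :
    MeasurePreserving (fun ω => (ω t).2) (N.processLaw ν) N.rateLaw :=
  measurePreserving_snd.comp (measurePreserving_eval t)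

theorem IsArrivalLaw.ae_isNonnegPath (hν : IsArrivalLaw lam ν) :
    ∀ᵐ ω ∂N.processLaw ν, N.IsNonnegPath ω := by
  have := hν.isProbability
  refine ae_all_iff.2 fun t => ?_
  filter_upwards [(measurePreserving_arrival (N := N) t).quasiMeasurePreserving.ae hν.nonneg,
    (measurePreserving_rate (N := N) (ν := ν) t).quasiMeasurePreserving.ae N.rate_nonneg]
    with ω h1 h2
  exact ⟨h1, h2⟩

theorem memLp_sum_rate : MemLp (fun r : N.Link → ℝ => ∑ e, r e) 2 N.rateLaw :=
  memLp_finsetSum _ fun e _ => N.rate_memLp e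

theorem IsArrivalLaw.memLp_queue (hν : IsArrivalLaw lam ν) (hπ : N.IsFeasiblePolicy π)
    (hQ₀ : N.IsQueueState Q₀) (t : ℕ) (i : V) (c : V ⊕ W) :
    MemLp (fun ω => N.queue π Q₀ ω t i c) 2 (N.processLaw ν) := by
  have := hν.isProbability
  induction t with
  | zero => exact memLp_const (Q₀ i c)
  | succ t ih =>
    refine MemLp.mono ((ih.add (memLp_sum_rate.comp_measurePreserving
      (measurePreserving_rate (N := N) (ν := ν) t))).add ((hν.memLp i c).comp_measurePreserving
      (measurePreserving_arrival t))) (measurable_queue_apply hπ _ i c).aestronglyMeasurable ?_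
    filter_upwards [hν.ae_isNonnegPath] with ω hω
    rw [Real.norm_of_nonneg ((isQueueState_queue hπ hQ₀ hω (t + 1)).1 i c)]
    exact (queue_succ_le hπ hQ₀ hω t i c).trans (le_abs_self _)

/-- The queues of a slot are independent of the arrivals and link rates of that slot. -/
theorem indepFun_queue_eval [IsProbabilityMeasure ν] (hπ : N.IsFeasiblePolicy π) (t : ℕ) :
    IndepFun (fun ω => N.queue π Q₀ ω t) (fun ω => ω t) (N.processLaw ν) := by
  have hind : iIndepFun (fun (s : ℕ) (ω : ℕ → (V → V ⊕ W → ℝ) × (N.Link → ℝ)) => ω s)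
      (N.processLaw ν) :=
    iIndepFun_infinitePi (P := fun _ : ℕ => ν.prod N.rateLaw) (X := fun _ y => y)
      fun _ => measurable_id
  have h := hind.indepFun_finset (Finset.range t) {t} (by simp) fun s => measurable_pi_apply s
  -- The queues at slot `t` depend only on slots before `t`, so they factor through the restriction
  -- to `Finset.range t`; the padding value `0` is never read.
  let extend : (Finset.range t → (V → V ⊕ W → ℝ) × (N.Link → ℝ)) →
      ℕ → (V → V ⊕ W → ℝ) × (N.Link → ℝ) :=
    fun f s => if hs : s ∈ Finset.range t then f ⟨s, hs⟩ else 0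
  have hextend : Measurable extend := by
    refine measurable_pi_iff.2 fun s => ?_
    by_cases hs : s ∈ Finset.range t
    · simp only [extend, dif_pos hs]
      exact measurable_pi_apply _
    · simp only [extend, dif_neg hs]
      exact measurable_const
  have h' := h.comp ((measurable_queue (Q₀ := Q₀) hπ t).comp hextend)
    (measurable_pi_apply (⟨t, Finset.mem_singleton_self t⟩ : ({t} : Finset ℕ)))
  have heq : (fun ω => N.queue π Q₀ ω t) = ((fun ω => N.queue π Q₀ ω t) ∘ extend) ∘
      fun (ω : ℕ → (V → V ⊕ W → ℝ) × (N.Link → ℝ)) (s : Finset.range t) => ω s := by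
    funext ω
    exact queue_congr fun s hs => by simp [extend, hs]
  rw [heq]
  exact h'

theorem IsArrivalLaw.integral_queue_mul_arrival (hν : IsArrivalLaw lam ν)
    (hπ : N.IsFeasiblePolicy π) (t : ℕ) (i : V) (c : V ⊕ W) :
    ∫ ω, N.queue π Q₀ ω t i c * (ω t).1 i c ∂N.processLaw ν =
      (∫ ω, N.queue π Q₀ ω t i c ∂N.processLaw ν) * lam i c := by
  have := hν.isProbability
  have hind : IndepFun (fun ω => N.queue π Q₀ ω t i c) (fun ω => (ω t).1 i c)
      (N.processLaw ν) :=
    (indepFun_queue_eval hπ t).comp (φ := fun Q : V → V ⊕ W → ℝ => Q i c)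
      (ψ := fun y : (V → V ⊕ W → ℝ) × (N.Link → ℝ) => y.1 i c)
      (by fun_prop) (by fun_prop)
  have hA : ∫ ω, (ω t).1 i c ∂N.processLaw ν = lam i c := by
    have hmp := measurePreserving_arrival (N := N) (ν := ν) t
    have h := integral_map hmp.measurable.aemeasurable (μ := N.processLaw ν)
      (by fun_prop : Measurable fun a : V → V ⊕ W → ℝ => a i c).aestronglyMeasurable
    rw [hmp.map_eq, hν.mean i c] at h
    exact h.symm
  rw [← hA]
  exact hind.integral_fun_mul_eq_mul_integral
    (measurable_queue_apply hπ t i c).aestronglyMeasurable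
    (by fun_prop : Measurable fun ω : ℕ → (V → V ⊕ W → ℝ) × (N.Link → ℝ) =>
      (ω t).1 i c).aestronglyMeasurable

theorem IsArrivalLaw.integrable_queue_mul_arrival (hν : IsArrivalLaw lam ν)
    (hπ : N.IsFeasiblePolicy π) (hQ₀ : N.IsQueueState Q₀) (t : ℕ) (i : V) (c : V ⊕ W) :
    Integrable (fun ω => N.queue π Q₀ ω t i c * (ω t).1 i c) (N.processLaw ν) := by
  have := hν.isProbability
  exact (hν.memLp_queue hπ hQ₀ t i c).integrable_mul
    ((hν.memLp i c).comp_measurePreserving (measurePreserving_arrival t))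

theorem IsArrivalLaw.integrable_queue (hν : IsArrivalLaw lam ν)
    (hπ : N.IsFeasiblePolicy π) (hQ₀ : N.IsQueueState Q₀) (t : ℕ) (i : V) (c : V ⊕ W) :
    Integrable (fun ω => N.queue π Q₀ ω t i c) (N.processLaw ν) := by
  have := hν.isProbability
  exact (hν.memLp_queue hπ hQ₀ t i c).integrable one_le_two

/-- The value is at most the total backlog times the total rate, a product of two square-integrable
functions. -/
theorem IsArrivalLaw.integrable_maxValue_queue (hν : IsArrivalLaw lam ν)
    (hπ : N.IsFeasiblePolicy π) (hQ₀ : N.IsQueueState Q₀) (t : ℕ) :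
    Integrable (fun ω => N.maxValue (N.queue π Q₀ ω t) (ω t).2) (N.processLaw ν) := by
  have := hν.isProbability
  have hsum : MemLp (fun ω => ∑ i, ∑ c, N.queue π Q₀ ω t i c) 2 (N.processLaw ν) :=
    memLp_finsetSum _ fun i _ => memLp_finsetSum _ fun c _ => hν.memLp_queue hπ hQ₀ t i c
  refine Integrable.mono' (hsum.integrable_mul (memLp_sum_rate.comp_measurePreserving
      (measurePreserving_rate (N := N) (ν := ν) t)))
    (N.measurable_maxValue.comp ((measurable_queue hπ t).prodMk
      (measurable_snd.comp (measurable_pi_apply t)))).aestronglyMeasurable ?_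
  filter_upwards [hν.ae_isNonnegPath] with ω hω
  rw [Real.norm_of_nonneg (N.maxValue_nonneg _ _)]
  refine (N.maxValue_le_sum (hω t).2).trans ?_
  simp only [Pi.mul_apply, Function.comp_apply]
  rw [mul_comm, Finset.sum_mul]
  exact Finset.sum_le_sum fun e _ => mul_le_mul_of_nonneg_left
    (N.gain_le_sum (isQueueState_queue hπ hQ₀ hω t).1 e) ((hω t).2 e)

/-- The current rates are independent of the queues, so the joint law is a product and Fubini
averages out the rates first. -/
theorem IsArrivalLaw.integral_maxValue_queue (hν : IsArrivalLaw lam ν)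
    (hπ : N.IsFeasiblePolicy π) (hQ₀ : N.IsQueueState Q₀) (t : ℕ) :
    ∫ ω, N.maxValue (N.queue π Q₀ ω t) (ω t).2 ∂N.processLaw ν =
        ∫ ω, N.meanValue (N.queue π Q₀ ω t) ∂N.processLaw ν ∧
      Integrable (fun ω => N.meanValue (N.queue π Q₀ ω t)) (N.processLaw ν) := by
  have := hν.isProbability
  have hQ := measurable_queue (Q₀ := Q₀) hπ t
  have hr := measurePreserving_rate (N := N) (ν := ν) t
  have hind : IndepFun (fun ω => N.queue π Q₀ ω t) (fun ω => (ω t).2) (N.processLaw ν) :=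
    (indepFun_queue_eval hπ t).comp measurable_id measurable_snd
  have hmap := (indepFun_iff_map_prod_eq_prod_map_map hQ.aemeasurable
    hr.measurable.aemeasurable).1 hind
  rw [hr.map_eq] at hmap
  have hpair := hQ.prodMk hr.measurable
  have hmeas := N.measurable_maxValue
  have hprob : IsProbabilityMeasure ((N.processLaw ν).map fun ω => N.queue π Q₀ ω t) :=
    Measure.isProbabilityMeasure_map hQ.aemeasurable
  have hint : Integrable (fun p : (V → V ⊕ W → ℝ) × (N.Link → ℝ) => N.maxValue p.1 p.2)
      (((N.processLaw ν).map fun ω => N.queue π Q₀ ω t).prod N.rateLaw) := by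
    rw [← hmap, integrable_map_measure hmeas.aestronglyMeasurable hpair.aemeasurable]
    exact hν.integrable_maxValue_queue hπ hQ₀ t
  constructor
  · calc ∫ ω, N.maxValue (N.queue π Q₀ ω t) (ω t).2 ∂N.processLaw ν
        = ∫ p, N.maxValue p.1 p.2
            ∂(N.processLaw ν).map fun ω => (N.queue π Q₀ ω t, (ω t).2) :=
          (integral_map hpair.aemeasurable hmeas.aestronglyMeasurable).symm
      _ = ∫ q, N.meanValue q ∂(N.processLaw ν).map fun ω => N.queue π Q₀ ω t := by
          rw [hmap, integral_prod _ hint]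
          rfl
      _ = ∫ ω, N.meanValue (N.queue π Q₀ ω t) ∂N.processLaw ν :=
          integral_map hQ.aemeasurable N.continuous_meanValue.measurable.aestronglyMeasurable
  · exact hint.integral_prod_left.comp_measurable hQ

/-- Strong stability in terms of real-valued expectations. -/
theorem IsArrivalLaw.isStronglyStable_iff (hν : IsArrivalLaw lam ν)
    (hπ : N.IsFeasiblePolicy π) (hQ₀ : N.IsQueueState Q₀) :
    N.IsStronglyStable π Q₀ ν ↔ ∀ i c, ∃ K : ℝ, ∀ᶠ T : ℕ in atTop,
      ∑ t ∈ Finset.range T, ∫ ω, N.queue π Q₀ ω t i c ∂N.processLaw ν ≤ T * K := by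
  have hnn : ∀ t i c, 0 ≤ᵐ[N.processLaw ν] fun ω => N.queue π Q₀ ω t i c := fun t i c => by
    filter_upwards [hν.ae_isNonnegPath] with ω hω
    exact (isQueueState_queue hπ hQ₀ hω t).1 i c
  have hsum : ∀ i c (T : ℕ),
      ∑ t ∈ Finset.range T, ∫⁻ ω, ENNReal.ofReal (N.queue π Q₀ ω t i c) ∂N.processLaw ν =
        ENNReal.ofReal (∑ t ∈ Finset.range T, ∫ ω, N.queue π Q₀ ω t i c ∂N.processLaw ν) := by
    intro i c T
    rw [ENNReal.ofReal_sum_of_nonneg fun t _ => integral_nonneg_of_ae (hnn t i c)]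
    exact Finset.sum_congr rfl fun t _ =>
      (ofReal_integral_eq_lintegral_ofReal (hν.integrable_queue hπ hQ₀ t i c) (hnn t i c)).symm
  have hsum0 : ∀ i c (T : ℕ),
      0 ≤ ∑ t ∈ Finset.range T, ∫ ω, N.queue π Q₀ ω t i c ∂N.processLaw ν := fun i c T =>
    Finset.sum_nonneg fun t _ => integral_nonneg_of_ae (hnn t i c)
  refine forall_congr' fun i => forall_congr' fun c => ?_
  simp only [hsum]
  constructor
  · intro h
    obtain ⟨K, hK, hKtop⟩ := exists_between h
    refine ⟨K.toReal, ?_⟩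
    filter_upwards [eventually_lt_of_limsup_lt hK, eventually_gt_atTop 0] with T hT hT0
    have hT0' : (0 : ℝ≥0∞) < T := by exact_mod_cast hT0
    have h1 := (ENNReal.div_le_iff hT0'.ne' (ENNReal.natCast_ne_top T)).1 hT.le
    rw [← ENNReal.ofReal_toReal hKtop.ne, ← ENNReal.ofReal_natCast,
      ← ENNReal.ofReal_mul ENNReal.toReal_nonneg] at h1
    have h2 := (ENNReal.ofReal_le_ofReal_iff (by positivity)).1 h1
    linarith
  · rintro ⟨K, hK⟩
    refine lt_of_le_of_lt (limsup_le_of_le (a := ENNReal.ofReal K) (h := ?_)) ENNReal.ofReal_lt_top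
    filter_upwards [hK, eventually_gt_atTop 0] with T hT hT0
    have hT0' : (0 : ℝ≥0∞) < T := by exact_mod_cast hT0
    rw [ENNReal.div_le_iff hT0'.ne' (ENNReal.natCast_ne_top T), mul_comm, ← ENNReal.ofReal_natCast,
      ← ENNReal.ofReal_mul (Nat.cast_nonneg T)]
    exact ENNReal.ofReal_le_ofReal hT

end WirelessNetwork

/-! ### Necessity: stabilized on-off arrivals satisfy strict inequalities -/

namespace WirelessNetwork

open ProbabilityTheory

variable {V W : Type*} [Fintype V] [Fintype W] {N : WirelessNetwork V W}
  {π : N.Policy} {Q₀ lam : V → V ⊕ W → ℝ} {ν : Measure (V → V ⊕ W → ℝ)}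

/-- All-or-nothing arrivals with rate vector `lam`. -/
noncomputable def onOffLaw (lam : V → V ⊕ W → ℝ) : Measure (V → V ⊕ W → ℝ) :=
  (2⁻¹ : ℝ≥0∞) • Measure.dirac 0 + (2⁻¹ : ℝ≥0∞) • Measure.dirac ((2 : ℝ) • lam)

instance : IsProbabilityMeasure (onOffLaw lam) := by
  refine ⟨?_⟩
  simp [onOffLaw, ENNReal.inv_two_add_inv_two]

theorem ae_onOffLaw_iff {p : (V → V ⊕ W → ℝ) → Prop} :
    (∀ᵐ a ∂onOffLaw lam, p a) ↔ p 0 ∧ p ((2 : ℝ) • lam) := by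
  rw [onOffLaw, ae_add_measure_iff, Measure.ae_ennreal_smul_measure_iff (by simp),
    Measure.ae_ennreal_smul_measure_iff (by simp), ae_dirac_eq, ae_dirac_eq, eventually_pure,
    eventually_pure]

theorem isArrivalLaw_onOffLaw (hlam : ∀ i c, 0 ≤ lam i c) : IsArrivalLaw lam (onOffLaw lam) := by
  have hmeas : ∀ i c, Measurable fun a : V → V ⊕ W → ℝ => a i c := fun i c => by fun_prop
  refine ⟨inferInstance, ?_, fun i c => ?_, fun i c => ?_⟩
  · refine ae_onOffLaw_iff.2 ⟨fun i c => le_rfl, fun i c => ?_⟩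
    exact mul_nonneg zero_le_two (hlam i c)
  · refine MemLp.of_bound (hmeas i c).aestronglyMeasurable (2 * lam i c) ?_
    refine ae_onOffLaw_iff.2 ⟨?_, ?_⟩
    · simpa using hlam i c
    · simp [abs_of_nonneg (hlam i c)]
  · have hint : ∀ b : V → V ⊕ W → ℝ, Integrable (fun a : V → V ⊕ W → ℝ => a i c)
        ((2⁻¹ : ℝ≥0∞) • Measure.dirac b) := fun b =>
      (integrable_dirac (by simp)).smul_measure (by simp)
    rw [onOffLaw, integral_add_measure (hint _) (hint _), integral_smul_measure,
      integral_smul_measure, integral_dirac, integral_dirac]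
    simp

/-- A monotone sequence dominated by a nonnegative one with bounded averages is bounded. -/
theorem le_four_mul_abs_of_sum_range_le {a L : ℕ → ℝ} {C : ℝ} (ha : Monotone a)
    (haL : ∀ n, a n ≤ L (n + 1)) (hL : ∀ n, 0 ≤ L n)
    (hC : ∀ᶠ T : ℕ in atTop, ∑ t ∈ Finset.range T, L t ≤ T * C) (m : ℕ) : a m ≤ 4 * |C| := by
  obtain ⟨T₀, hT₀⟩ := eventually_atTop.1 hC
  -- On the window from `s` to `2 * s` every `L` is at least `a m`, while the sum up to `2 * s` is
  -- at most `2 * s * C`. Hence `s * a m ≤ 2 * s * C`; the factor `4` is generous.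
  set s := max (m + 1) T₀ with hs
  have h1 := hT₀ (s + s) (by omega)
  rw [Finset.sum_range_add] at h1
  have h2 : 0 ≤ ∑ t ∈ Finset.range s, L t := Finset.sum_nonneg fun t _ => hL t
  have h3 : (s : ℝ) * a m ≤ ∑ t ∈ Finset.range s, L (s + t) := by
    have h : ∑ _t ∈ Finset.range s, a m ≤ ∑ t ∈ Finset.range s, L (s + t) := by
      refine Finset.sum_le_sum fun t _ => ?_
      have hst : s + t = (s + t - 1) + 1 := by omega
      rw [hst]
      exact (ha (by omega : m ≤ s + t - 1)).trans (haL _)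
    simpa using h
  have hs0 : (0 : ℝ) < s := by
    have : 0 < s := by omega
    exact_mod_cast this
  push_cast at h1
  by_contra! hm
  have h4 : (s : ℝ) * (4 * |C|) < s * a m := mul_lt_mul_of_pos_left hm hs0
  have h5 : (s : ℝ) * C ≤ s * |C| := mul_le_mul_of_nonneg_left (le_abs_self C) hs0.le
  have h6 : 0 ≤ (s : ℝ) * |C| := by positivity
  linarith

variable (N) in
/-- The arrivals of a slot, weighted by `q`, minus the largest possible weighted service. -/
noncomputable def excess (q : V → V ⊕ W → ℝ) (y : (V → V ⊕ W → ℝ) × (N.Link → ℝ)) : ℝ :=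
  ∑ i, ∑ c, q i c * y.1 i c - N.maxValue q y.2

theorem measurable_excess (q : V → V ⊕ W → ℝ) : Measurable (N.excess q) := by
  have hm : ∀ i c, Measurable fun y : (V → V ⊕ W → ℝ) × (N.Link → ℝ) => y.1 i c :=
    fun i c => by fun_prop
  have h : Measurable fun y : (V → V ⊕ W → ℝ) × (N.Link → ℝ) => ∑ i, ∑ c, q i c * y.1 i c :=
    Finset.measurable_fun_sum _ fun i _ => Finset.measurable_fun_sum _ fun c _ =>
      (hm i c).const_mul _
  have hmax : Measurable (N.maxValue q) := N.measurable_maxValue.comp measurable_prodMk_left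
  have hmax' : Measurable fun y : (V → V ⊕ W → ℝ) × (N.Link → ℝ) => N.maxValue q y.2 :=
    hmax.comp measurable_snd
  exact h.sub hmax'

theorem IsArrivalLaw.integrable_excess (hν : IsArrivalLaw lam ν) (q : V → V ⊕ W → ℝ) :
    Integrable (N.excess q) (ν.prod N.rateLaw) ∧
      ∫ y, N.excess q y ∂ν.prod N.rateLaw = ∑ i, ∑ c, q i c * lam i c - N.meanValue q := by
  have := hν.isProbability
  have hA : ∀ i c, Integrable (fun a : V → V ⊕ W → ℝ => q i c * a i c) ν := fun i c =>
    ((hν.memLp i c).integrable one_le_two).const_mul _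
  have hAsum : Integrable (fun a : V → V ⊕ W → ℝ => ∑ i, ∑ c, q i c * a i c) ν :=
    integrable_finsetSum _ fun i _ => integrable_finsetSum _ fun c _ => hA i c
  have hint1 : Integrable (fun y : (V → V ⊕ W → ℝ) × (N.Link → ℝ) =>
      ∑ i, ∑ c, q i c * y.1 i c) (ν.prod N.rateLaw) := hAsum.comp_fst _
  have hint2 : Integrable (fun y : (V → V ⊕ W → ℝ) × (N.Link → ℝ) => N.maxValue q y.2)
      (ν.prod N.rateLaw) := (N.integrable_maxValue q).comp_snd _
  refine ⟨hint1.sub hint2, ?_⟩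
  have h1 : ∫ y, N.excess q y ∂ν.prod N.rateLaw =
      (∫ a, ∑ i, ∑ c, q i c * a i c ∂ν) - N.meanValue q := by
    have h2 := integral_fun_fst (μ := ν) (ν := N.rateLaw)
      (fun a : V → V ⊕ W → ℝ => ∑ i, ∑ c, q i c * a i c)
    have h3 := integral_fun_snd (μ := ν) (ν := N.rateLaw) (N.maxValue q)
    rw [probReal_univ, one_smul] at h2 h3
    rw [meanValue, ← h2, ← h3]
    exact integral_sub hint1 hint2
  rw [h1, integral_finsetSum _ fun i _ => integrable_finsetSum _ fun c _ => hA i c]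
  congr 1
  refine Finset.sum_congr rfl fun i _ => ?_
  rw [integral_finsetSum _ fun c _ => hA i c]
  exact Finset.sum_congr rfl fun c _ => by rw [integral_const_mul, hν.mean]

/-- At the same link rates, the two atoms `0` and `2 * lam` give excesses that differ by `2 * ∑ q *
lam > 0`, so they cannot both vanish. -/
theorem not_ae_excess_eq_zero {q : V → V ⊕ W → ℝ} (hpos : 0 < ∑ i, ∑ c, q i c * lam i c) :
    ¬ ∀ᵐ y ∂(onOffLaw lam).prod N.rateLaw, N.excess q y = 0 := by
  intro h
  have h2 := Measure.ae_ae_of_ae_prod h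
  rw [ae_onOffLaw_iff] at h2
  obtain ⟨r, hr1, hr2⟩ := (h2.1.and h2.2).exists
  have h3 : ∑ i, ∑ c, q i c * ((2 : ℝ) • lam) i c = 2 * ∑ i, ∑ c, q i c * lam i c := by
    simp only [Pi.smul_apply, smul_eq_mul, Finset.mul_sum]
    exact Finset.sum_congr rfl fun i _ => Finset.sum_congr rfl fun c _ => by ring
  simp only [excess, h3] at hr1 hr2
  simp only [Pi.zero_apply, mul_zero, Finset.sum_const_zero] at hr1
  linarith

/-- Strong stability bounds the averages of every nonnegatively weighted expected backlog. -/
theorem IsStronglyStable.eventually_sum_integral_le (hπ : N.IsFeasiblePolicy π)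
    (hQ₀ : N.IsQueueState Q₀) (hν : IsArrivalLaw lam ν) (hstab : N.IsStronglyStable π Q₀ ν)
    {q : V → V ⊕ W → ℝ} (hq0 : ∀ i c, 0 ≤ q i c) :
    ∃ C : ℝ, ∀ᶠ T : ℕ in atTop, ∑ t ∈ Finset.range T,
      ∫ ω, ∑ i, ∑ c, q i c * N.queue π Q₀ ω t i c ∂N.processLaw ν ≤ T * C := by
  choose K hK using (hν.isStronglyStable_iff hπ hQ₀).1 hstab
  refine ⟨∑ i, ∑ c, q i c * K i c, ?_⟩
  filter_upwards [eventually_all.2 fun i => eventually_all.2 fun c => hK i c] with T hT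
  have h1 : ∀ t, ∫ ω, ∑ i, ∑ c, q i c * N.queue π Q₀ ω t i c ∂N.processLaw ν =
      ∑ i, ∑ c, q i c * ∫ ω, N.queue π Q₀ ω t i c ∂N.processLaw ν := fun t => by
    rw [integral_finsetSum _ fun i _ => integrable_finsetSum _ fun c _ =>
      (hν.integrable_queue hπ hQ₀ t i c).const_mul _]
    refine Finset.sum_congr rfl fun i _ => ?_
    rw [integral_finsetSum _ fun c _ => (hν.integrable_queue hπ hQ₀ t i c).const_mul _]
    exact Finset.sum_congr rfl fun c _ => integral_const_mul _ _
  simp only [h1]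
  rw [Finset.sum_comm, Finset.mul_sum]
  refine Finset.sum_le_sum fun i _ => ?_
  rw [Finset.sum_comm, Finset.mul_sum]
  refine Finset.sum_le_sum fun c _ => ?_
  rw [← Finset.mul_sum]
  have := mul_le_mul_of_nonneg_left (hT i c) (hq0 i c)
  linarith

/-- If on-off arrivals are stabilized, then every weighted sum of arrival rates that is positive
is strictly below the mean maximum weight. -/
theorem IsStronglyStable.sum_mul_lt_meanValue (hπ : N.IsFeasiblePolicy π)
    (hQ₀ : N.IsQueueState Q₀) (hlam : ∀ i c, 0 ≤ lam i c)
    (hstab : N.IsStronglyStable π Q₀ (onOffLaw lam)) {q : V → V ⊕ W → ℝ}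
    (hq0 : ∀ i c, 0 ≤ q i c) (hq : ∀ i c, N.IsDestination i c → q i c = 0)
    (hpos : 0 < ∑ i, ∑ c, q i c * lam i c) :
    ∑ i, ∑ c, q i c * lam i c < N.meanValue q := by
  by_contra! hle
  have hν := isArrivalLaw_onOffLaw hlam
  have hF : Measurable (N.excess q) := measurable_excess q
  obtain ⟨hFint, hFmean⟩ := hν.integrable_excess (N := N) q
  have hmp : ∀ n : ℕ, MeasurePreserving (fun ω => ω n) (N.processLaw (onOffLaw lam))
    ((onOffLaw lam).prod N.rateLaw) := fun n => measurePreserving_eval n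
  have hXmeas : ∀ n : ℕ, Measurable fun ω : ℕ → (V → V ⊕ W → ℝ) × (N.Link → ℝ) =>
      N.excess q (ω n) := fun n => hF.comp (measurable_pi_apply n)
  have hXint : ∀ n : ℕ, Integrable (fun ω => N.excess q (ω n)) (N.processLaw (onOffLaw lam)) :=
    fun n => (hmp n).integrable_comp_of_integrable hFint
  have hXmap : ∀ n : ℕ, (N.processLaw (onOffLaw lam)).map (fun ω => N.excess q (ω n)) =
      ((onOffLaw lam).prod N.rateLaw).map (N.excess q) := fun n => by
    rw [← (hmp n).map_eq, Measure.map_map hF (measurable_pi_apply n)]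
    rfl
  have hXmean : ∀ n : ℕ, 0 ≤ ∫ ω, N.excess q (ω n) ∂N.processLaw (onOffLaw lam) := fun n => by
    have h := integral_map (μ := N.processLaw (onOffLaw lam)) (hmp n).measurable.aemeasurable
      (f := N.excess q) hF.aestronglyMeasurable
    rw [(hmp n).map_eq, hFmean] at h
    exact (sub_nonneg.2 hle).trans h.le
  have hXindep : iIndepFun (fun (n : ℕ) (ω : ℕ → (V → V ⊕ W → ℝ) × (N.Link → ℝ)) =>
      N.excess q (ω n)) (N.processLaw (onOffLaw lam)) :=
    iIndepFun_infinitePi (P := fun _ : ℕ => (onOffLaw lam).prod N.rateLaw)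
      (X := fun _ => N.excess q) fun _ => hF
  have hne : ¬ (fun ω : ℕ → (V → V ⊕ W → ℝ) × (N.Link → ℝ) => N.excess q (ω 0))
      =ᵐ[N.processLaw (onOffLaw lam)] 0 := by
    intro h
    refine not_ae_excess_eq_zero (N := N) hpos ?_
    rw [← (hmp 0).map_eq]
    exact (ae_map_iff (hmp 0).measurable.aemeasurable
      (measurableSet_eq_fun hF measurable_const)).2 h
  have hLint : ∀ t, Integrable (fun ω => ∑ i, ∑ c, q i c * N.queue π Q₀ ω t i c)
      (N.processLaw (onOffLaw lam)) := fun t =>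
    integrable_finsetSum _ fun i _ => integrable_finsetSum _ fun c _ =>
      (hν.integrable_queue hπ hQ₀ t i c).const_mul _
  have hL0 : ∀ t, 0 ≤ᵐ[N.processLaw (onOffLaw lam)]
      fun ω => ∑ i, ∑ c, q i c * N.queue π Q₀ ω t i c := fun t => by
    filter_upwards [hν.ae_isNonnegPath] with ω hω
    exact Finset.sum_nonneg fun i _ => Finset.sum_nonneg fun c _ =>
      mul_nonneg (hq0 i c) ((isQueueState_queue hπ hQ₀ hω t).1 i c)
  obtain ⟨C, hC⟩ := IsStronglyStable.eventually_sum_integral_le hπ hQ₀ hν hstab hq0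
  obtain ⟨m, hm⟩ := exists_lt_integral_posPart_sum hXmeas hXindep
    (fun n => (hXmap n).trans (hXmap 0).symm) hXint hXmean hne (4 * |C|)
  -- Stability bounds only time averages. Monotonicity of the expected positive parts upgrades this
  -- to a bound at every time, which the choice of `m` violates.
  refine hm.not_ge (le_four_mul_abs_of_sum_range_le
    (monotone_integral_posPart_sum hXmeas hXindep hXint hXmean) (fun n => ?_)
    (fun t => integral_nonneg_of_ae (hL0 t)) hC m)
  refine integral_mono_ae (integrable_finsetSum _ fun s _ => hXint s).pos_part
    (hLint (n + 1)) ?_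
  filter_upwards [hν.ae_isNonnegPath, hL0 (n + 1)] with ω hω h0
  exact max_le (sum_range_le_sum_mul_queue hπ hQ₀ hω hq0 hq (n + 1)) h0

theorem meanValue_eq_zero_of_gain_nonpos {q : V → V ⊕ W → ℝ} (h : ∀ e, N.gain q e ≤ 0) :
    N.meanValue q = 0 := by
  refine le_antisymm ?_ (N.meanValue_nonneg q)
  have h1 := N.meanValue_mono (q' := 0) fun e => (h e).trans (N.gain_nonneg 0 e)
  have h2 := N.meanValue_smul le_rfl (0 : V → V ⊕ W → ℝ)
  rw [smul_zero, zero_mul] at h2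
  rwa [h2] at h1

/-- Stabilized commodities without destinations have no arrivals. -/
theorem IsStronglyStable.eq_zero_of_forall_not_isDestination (hπ : N.IsFeasiblePolicy π)
    (hQ₀ : N.IsQueueState Q₀) (hlam : ∀ i c, 0 ≤ lam i c)
    (hstab : N.IsStronglyStable π Q₀ (onOffLaw lam)) {c : V ⊕ W}
    (hc : ∀ j, ¬ N.IsDestination j c) (i : V) : lam i c = 0 := by
  classical
  -- This weight is constant over devices, so its gains and mean value are zero; a positive total
  -- arrival rate would then have to be negative.
  let q : V → V ⊕ W → ℝ := fun _ c' => if c' = c then 1 else 0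
  have hsum : ∑ i, ∑ c', q i c' * lam i c' = ∑ i, lam i c := by
    simp only [q, ite_mul, one_mul, zero_mul, Finset.sum_ite_eq', Finset.mem_univ, if_true]
  by_contra hne
  have hpos : 0 < ∑ i, lam i c :=
    Finset.sum_pos' (fun i _ => hlam i c)
      ⟨i, Finset.mem_univ i, lt_of_le_of_ne (hlam i c) (Ne.symm hne)⟩
  have h := IsStronglyStable.sum_mul_lt_meanValue hπ hQ₀ hlam hstab (q := q)
    (fun i c' => by simp only [q]; split_ifs <;> norm_num)
    (fun i c' hi => if_neg fun h' => hc i (by rwa [h'] at hi)) (by rwa [hsum])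
  rw [hsum, meanValue_eq_zero_of_gain_nonpos fun e => N.gain_le le_rfl fun c' => by simp [q]] at h
  exact lt_asymm h hpos

/-- The random-walk argument needs a positive weighted arrival rate. Otherwise it is enough that the
mean value is positive, which holds for nonzero hosted states by connectivity. -/
theorem IsStronglyStable.sum_mul_lt_meanValue_of_isHostedState (hπ : N.IsFeasiblePolicy π)
    (hQ₀ : N.IsQueueState Q₀) (hlam : ∀ i c, 0 ≤ lam i c)
    (hstab : N.IsStronglyStable π Q₀ (onOffLaw lam)) {q : V → V ⊕ W → ℝ}
    (hq : N.IsHostedState q) (hne : q ≠ 0) :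
    ∑ i, ∑ c, q i c * lam i c < N.meanValue q := by
  rcases le_or_gt (∑ i, ∑ c, q i c * lam i c) 0 with h | h
  · refine h.trans_lt ?_
    by_contra! hle
    exact hne (N.eq_zero_of_meanValue_nonpos hq hle)
  · exact IsStronglyStable.sum_mul_lt_meanValue hπ hQ₀ hlam hstab hq.1 hq.2.1 h

/-! ### Sufficiency: quadratic Lyapunov drift of link sharing -/

theorem IsArrivalLaw.integrable_driftConstant (hν : IsArrivalLaw lam ν) :
    Integrable N.driftConstant (ν.prod N.rateLaw) := by
  have := hν.isProbability
  have hr : ∀ e, MemLp (fun y : (V → V ⊕ W → ℝ) × (N.Link → ℝ) => y.2 e) 2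
      (ν.prod N.rateLaw) := fun e => (N.rate_memLp e).comp_measurePreserving measurePreserving_snd
  have hA : ∀ i c, MemLp (fun y : (V → V ⊕ W → ℝ) × (N.Link → ℝ) => y.1 i c) 2
      (ν.prod N.rateLaw) := fun i c =>
    (hν.memLp i c).comp_measurePreserving measurePreserving_fst
  refine Integrable.add ?_ (Integrable.const_mul ?_ 2)
  · exact integrable_finsetSum _ fun i _ => integrable_finsetSum _ fun c _ =>
      ((memLp_finsetSum _ fun e _ => hr e).add (hA i c)).integrable_sq
  · exact integrable_finsetSum _ fun e _ =>
      (hr e).integrable_mul ((hr e).add (memLp_const (3 * N.totalBias)))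

/-- A commodity without destinations and without arrivals keeps its total backlog. -/
theorem sum_queue_eq_of_forall_not_isDestination
    {ω : ℕ → (V → V ⊕ W → ℝ) × (N.Link → ℝ)} {c : V ⊕ W}
    (hc : ∀ j, ¬ N.IsDestination j c) (h : ∀ t i, (ω t).1 i c = 0) (t : ℕ) :
    ∑ i, N.queue π Q₀ ω t i c = ∑ i, Q₀ i c := by
  induction t with
  | zero => rfl
  | succ t ih =>
    rw [sum_queue_succ_of_forall_not_isDestination hc, ih]
    simp [h t]

theorem IsArrivalLaw.ae_arrival_eq_zero {V W : Type*} {lam : V → V ⊕ W → ℝ}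
    {ν : Measure (V → V ⊕ W → ℝ)} (hν : IsArrivalLaw lam ν) {i : V} {c : V ⊕ W}
    (h : lam i c = 0) : ∀ᵐ a ∂ν, a i c = 0 := by
  have := hν.isProbability
  have h1 : (fun a : V → V ⊕ W → ℝ => a i c) =ᵐ[ν] 0 := by
    rw [← integral_eq_zero_iff_of_nonneg_ae _ ((hν.memLp i c).integrable one_le_two), hν.mean, h]
    filter_upwards [hν.nonneg] with a ha
    exact ha i c
  exact h1

/-- One-slot drift of the expected quadratic backlog under link sharing. -/
theorem IsMaxUSPBP.integral_sum_queue_succ_sq_le (hπ : N.IsMaxUSPBP π) (hQ₀ : N.IsQueueState Q₀)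
    (hν : IsArrivalLaw lam ν) (t : ℕ) :
    ∫ ω, ∑ i, ∑ c, N.queue π Q₀ ω (t + 1) i c ^ 2 ∂N.processLaw ν ≤
      ∫ ω, ∑ i, ∑ c, N.queue π Q₀ ω t i c ^ 2 ∂N.processLaw ν +
        2 * ∫ ω, ((∑ i, ∑ c, N.queue π Q₀ ω t i c * lam i c) -
          N.meanValue (N.queue π Q₀ ω t)) ∂N.processLaw ν +
        ∫ y, N.driftConstant y ∂ν.prod N.rateLaw := by
  have := hν.isProbability
  have hf := hπ.isFeasiblePolicy
  have hsq : ∀ t, Integrable (fun ω => ∑ i, ∑ c, N.queue π Q₀ ω t i c ^ 2) (N.processLaw ν) :=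
    fun t => integrable_finsetSum _ fun i _ => integrable_finsetSum _ fun c _ =>
      (hν.memLp_queue hf hQ₀ t i c).integrable_sq
  have hQA : Integrable (fun ω => ∑ i, ∑ c, N.queue π Q₀ ω t i c * (ω t).1 i c)
      (N.processLaw ν) :=
    integrable_finsetSum _ fun i _ => integrable_finsetSum _ fun c _ =>
      hν.integrable_queue_mul_arrival hf hQ₀ t i c
  have hQlam : Integrable (fun ω => ∑ i, ∑ c, N.queue π Q₀ ω t i c * lam i c)
      (N.processLaw ν) :=
    integrable_finsetSum _ fun i _ => integrable_finsetSum _ fun c _ =>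
      (hν.integrable_queue hf hQ₀ t i c).mul_const _
  have hmax := hν.integrable_maxValue_queue hf hQ₀ t
  obtain ⟨hmean, hmeanint⟩ := hν.integral_maxValue_queue hf hQ₀ t
  have hmp := measurePreserving_eval (N := N) (ν := ν) t
  have hD := hν.integrable_driftConstant (N := N)
  have hDint : Integrable (fun ω => N.driftConstant (ω t)) (N.processLaw ν) :=
    hmp.integrable_comp_of_integrable hD
  have hDeq : ∫ ω, N.driftConstant (ω t) ∂N.processLaw ν =
      ∫ y, N.driftConstant y ∂ν.prod N.rateLaw := by
    rw [← hmp.map_eq]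
    refine (integral_map hmp.measurable.aemeasurable ?_).symm
    rw [hmp.map_eq]
    exact hD.aestronglyMeasurable
  have hQAeq : ∫ ω, ∑ i, ∑ c, N.queue π Q₀ ω t i c * (ω t).1 i c ∂N.processLaw ν =
      ∫ ω, ∑ i, ∑ c, N.queue π Q₀ ω t i c * lam i c ∂N.processLaw ν := by
    rw [integral_finsetSum _ fun i _ => integrable_finsetSum _ fun c _ =>
        hν.integrable_queue_mul_arrival hf hQ₀ t i c,
      integral_finsetSum _ fun i _ => integrable_finsetSum _ fun c _ =>
        (hν.integrable_queue hf hQ₀ t i c).mul_const _]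
    refine Finset.sum_congr rfl fun i _ => ?_
    rw [integral_finsetSum _ fun c _ => hν.integrable_queue_mul_arrival hf hQ₀ t i c,
      integral_finsetSum _ fun c _ => (hν.integrable_queue hf hQ₀ t i c).mul_const _]
    refine Finset.sum_congr rfl fun c _ => ?_
    rw [hν.integral_queue_mul_arrival hf, integral_mul_const]
  have hle := integral_mono_ae (hsq (t + 1))
    ((((hsq t).add (hQA.const_mul 2)).sub (hmax.const_mul 2)).add hDint)
    (hν.ae_isNonnegPath.mono fun ω hω => hπ.sum_queue_succ_sq_le hQ₀ hω t)
  rw [integral_add' (((hsq t).add (hQA.const_mul 2)).sub (hmax.const_mul 2)) hDint,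
    integral_sub' ((hsq t).add (hQA.const_mul 2)) (hmax.const_mul 2),
    integral_add' (hsq t) (hQA.const_mul 2), integral_const_mul, integral_const_mul, hQAeq, hmean,
    hDeq] at hle
  rw [integral_sub hQlam hmeanint]
  linarith

/-- Link sharing stabilizes arrival rates that are uniformly supported against every queue state
and vanish for commodities without destinations. -/
theorem IsMaxUSPBP.isStronglyStable (hπ : N.IsMaxUSPBP π) (hQ₀ : N.IsQueueState Q₀)
    (hν : IsArrivalLaw lam ν)
    (hzero : ∀ c, (∀ j, ¬ N.IsDestination j c) → ∀ i, lam i c = 0)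
    {ε : ℝ} (hε : 0 < ε)
    (hslack : ∀ q, N.IsHostedState q →
      ∑ i, ∑ c, q i c * lam i c + ε * ∑ i, ∑ c, q i c ≤ N.meanValue q) :
    N.IsStronglyStable π Q₀ ν := by
  have := hν.isProbability
  have hf := hπ.isFeasiblePolicy
  rw [hν.isStronglyStable_iff hf hQ₀]
  intro i c
  by_cases hc : ∃ j, N.IsDestination j c
  · set Φ : ℕ → ℝ := fun t => ∫ ω, ∑ i, ∑ c, N.queue π Q₀ ω t i c ^ 2 ∂N.processLaw ν with hΦ
    set D := ∫ y, N.driftConstant y ∂ν.prod N.rateLaw with hD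
    have hΦ0 : ∀ t, 0 ≤ Φ t := fun t => integral_nonneg fun ω =>
      Finset.sum_nonneg fun i _ => Finset.sum_nonneg fun c _ => sq_nonneg _
    -- The slack inequality is applied to the hosted part of the current queue state. The weighted
    -- arrival rate is unchanged by this restriction because `lam` vanishes on the remaining
    -- commodities.
    have hstep : ∀ t, Φ (t + 1) + 2 * ε * ∫ ω, N.queue π Q₀ ω t i c ∂N.processLaw ν ≤
        Φ t + D := by
      intro t
      have h1 := hπ.integral_sum_queue_succ_sq_le hQ₀ hν t
      have hQlam : Integrable (fun ω => ∑ i, ∑ c, N.queue π Q₀ ω t i c * lam i c)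
          (N.processLaw ν) :=
        integrable_finsetSum _ fun i _ => integrable_finsetSum _ fun c _ =>
          (hν.integrable_queue hf hQ₀ t i c).mul_const _
      have h2 : ∫ ω, ((∑ i, ∑ c, N.queue π Q₀ ω t i c * lam i c) -
          N.meanValue (N.queue π Q₀ ω t)) ∂N.processLaw ν ≤
          ∫ ω, -ε * N.queue π Q₀ ω t i c ∂N.processLaw ν := by
        refine integral_mono_ae (hQlam.sub (hν.integral_maxValue_queue hf hQ₀ t).2)
          ((hν.integrable_queue hf hQ₀ t i c).const_mul _) ?_
        filter_upwards [hν.ae_isNonnegPath] with ω hω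
        have hQ := isQueueState_queue hf hQ₀ hω t
        have hH := hQ.isHostedState_hostedPart
        have h3 := hslack _ hH
        have h4 := N.meanValue_mono (gain_hostedPart_le (N.queue π Q₀ ω t))
        have h5 : ∑ i, ∑ c, N.hostedPart (N.queue π Q₀ ω t) i c * lam i c =
            ∑ i, ∑ c, N.queue π Q₀ ω t i c * lam i c := by
          refine Finset.sum_congr rfl fun i _ => Finset.sum_congr rfl fun c _ => ?_
          by_cases hc : ∃ j, N.IsDestination j c
          · rw [hostedPart_of_exists hc]
          · rw [hzero c (not_exists.1 hc), mul_zero, mul_zero]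
        have h6 : N.queue π Q₀ ω t i c ≤ ∑ i, ∑ c, N.hostedPart (N.queue π Q₀ ω t) i c := by
          rw [← hostedPart_of_exists hc (N.queue π Q₀ ω t) i]
          exact (Finset.single_le_sum (fun c _ => hH.1 i c) (Finset.mem_univ c)).trans
            (Finset.single_le_sum
              (f := fun i => ∑ c, N.hostedPart (N.queue π Q₀ ω t) i c)
              (fun i _ => Finset.sum_nonneg fun c _ => hH.1 i c) (Finset.mem_univ i))
        have h7 := mul_le_mul_of_nonneg_left h6 hε.le
        linarith
      rw [integral_const_mul] at h2
      linarith
    have hsum : ∀ T : ℕ, Φ T + 2 * ε * ∑ t ∈ Finset.range T,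
        ∫ ω, N.queue π Q₀ ω t i c ∂N.processLaw ν ≤ Φ 0 + T * D := by
      intro T
      induction T with
      | zero => simp
      | succ T ih =>
        rw [Finset.sum_range_succ]
        have := hstep T
        push_cast
        linarith
    -- In the telescoped bound `Φ T` is nonnegative and is dropped, and `Φ 0 ≤ T * Φ 0` for `T ≥ 1`.
    refine ⟨(Φ 0 + D) / (2 * ε), ?_⟩
    filter_upwards [eventually_ge_atTop 1] with T hT
    have hT' : (1 : ℝ) ≤ T := by exact_mod_cast hT
    rw [← mul_div_assoc, le_div_iff₀ (by positivity)]
    have h1 := hsum T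
    have h2 := hΦ0 T
    have h3 := le_mul_of_one_le_left (hΦ0 0) hT'
    linarith
  · push Not at hc
    refine ⟨∑ j, Q₀ j c, Eventually.of_forall fun T => ?_⟩
    have hA : ∀ᵐ ω ∂N.processLaw ν, ∀ t i, (ω t).1 i c = 0 :=
      ae_all_iff.2 fun t => ae_all_iff.2 fun i =>
        (measurePreserving_arrival (N := N) t).quasiMeasurePreserving.ae
          (hν.ae_arrival_eq_zero (hzero c hc i))
    have hle : ∀ t, ∫ ω, N.queue π Q₀ ω t i c ∂N.processLaw ν ≤ ∑ j, Q₀ j c := by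
      intro t
      have h1 : ∫ ω, N.queue π Q₀ ω t i c ∂N.processLaw ν ≤
          ∫ _, ∑ j, Q₀ j c ∂N.processLaw ν := by
        refine integral_mono_ae (hν.integrable_queue hf hQ₀ t i c) (integrable_const _) ?_
        filter_upwards [hν.ae_isNonnegPath, hA] with ω hω h0
        have hQ := isQueueState_queue hf hQ₀ hω t
        rw [← sum_queue_eq_of_forall_not_isDestination (π := π) (Q₀ := Q₀) hc h0 t]
        exact Finset.single_le_sum (fun j _ => hQ.1 j c) (Finset.mem_univ i)
      simpa using h1
    refine (Finset.sum_le_sum fun t _ => hle t).trans ?_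
    simp

end WirelessNetwork

theorem theorem1 {V W : Type*} [Fintype V] [Fintype W] (N : WirelessNetwork V W)
    (Q₀ : V → V ⊕ W → ℝ) (hQ₀ : ∀ i c, 0 ≤ Q₀ i c)
    (hQ₀_dest : ∀ i c, N.IsDestination i c → Q₀ i c = 0)
    (πClassic πMaxU : N.Policy)
    (hClassic : N.IsClassicSPBP πClassic) (hMaxU : N.IsMaxUSPBP πMaxU) :
    N.capacityRegion πClassic Q₀ ⊆ N.capacityRegion πMaxU Q₀ := by
  rintro lam ⟨hlam, hstable⟩
  -- Stability of the classic policy is used for this one arrival law only; the resulting slack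
  -- depends on `lam` alone and so serves every law `ν` with that mean.
  have hstab := hstable _ (WirelessNetwork.isArrivalLaw_onOffLaw hlam)
  have hπ := hClassic.isFeasiblePolicy
  have hQ : N.IsQueueState Q₀ := ⟨hQ₀, hQ₀_dest⟩
  obtain ⟨ε, hε, hslack⟩ := N.exists_pos_forall_add_le_meanValue fun q hq hne =>
    WirelessNetwork.IsStronglyStable.sum_mul_lt_meanValue_of_isHostedState hπ hQ hlam hstab hq hne
  exact ⟨hlam, fun ν hν => hMaxU.isStronglyStable hQ hν
    (fun c hc i => WirelessNetwork.IsStronglyStable.eq_zero_of_forall_not_isDestination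
      hπ hQ hlam hstab hc i) hε hslack⟩
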